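/- Let $d>0$ and $\alpha\ge 0$. Put $$\Omega=\{(x,y)\in\mathbb R^2:\ x\ge 0,\ y\ge 0,\ |x-y|\le d\},\qquad \partial\Omega_D=\{(x,y)\in\Omega:\ |x-y|=d\},$$ and let $L^2_s(\Omega)=\{\varphi\in L^2(\Omega):\ \varphi(x,y)=\varphi(y,x)\text{ for a.e. }(x,y)\}$ (complex-valued functions). Let $H^1(\Omega)$ be the Sobolev space of all $\varphi\in L^2(\Omega)$ whose weak first partial derivatives on the interior of $\Omega$ belong to $L^2(\Omega)$. The traces of $\varphi\in H^1(\Omega)$ on the diagonal $\{x=y\}$ and on the two half-lines forming $\partial\Omega_D$ are understood as the extension by continuity, from $H^1(\Omega)$ to $L^2(0,\infty)$, of the restriction of functions that are smooth up to the boundary. On $$\mathcal D_q=\{\varphi\in H^1(\Omega):\ \varphi(x,y)=\varphi(y,x),\ \varphi|_{\partial\Omega_D}=0\}\subset L^2_s(\Omega)$$ consider the form $$q_\alpha[\varphi]=\int_\Omega|\nabla\varphi|^2\,dx\,dy+\alpha\int_0^\infty|\varphi(x,x)|^2\,dx .$$ Theorem. The weak gradient and the traces above exist and are unique for every $\varphi\in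 H^1(\Omega)$, and $q_\alpha$ is the quadratic form of the sesquilinear form $$q_\alpha(\eta,\varphi)=\int_\Omega\overline{\nabla\eta}\cdot\nabla\varphi\,dx\,dy+\alpha\int_0^\infty\overline{\eta(x,x)}\,\varphi(x,x)\,dx,\qquad \eta,\varphi\in\mathcal D_q .$$ On the Hilbert space $L^2_s(\Omega)$ the form $q_\alpha$ is: * densely defined: $\mathcal D_q$ is dense in $L^2_s(\Omega)$; * closed: if $\varphi_n\in\mathcal D_q$, $\varphi_n\to\varphi$ in $L^2_s(\Omega)$ and $q_\alpha[\varphi_n-\varphi_m]\to0$ as $n,m\to\infty$, then $\varphi\in\mathcal D_q$ and $q_\alpha[\varphi_n-\varphi]\to0$; * bounded from below: there is $m\in\mathbb R$ with $q_\alpha[\varphi]\ge m\|\varphi\|^2$ for all $\varphi\in\mathcal D_q$. Consequently there is a self-adjoint operator $H_\alpha$ on $L^2_s(\Omega)$ such that $\varphi\in D(H_\alpha)$ with $H_\alpha\varphi=\psi$ if and only if $\varphi\in\mathcal D_q$ and $q_\alpha(\eta,\varphi)=\langle\eta,\psi\rangle$ for all $\eta\in\mathcal D_q$. It is the only self-adjoint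 operator $H$ with $D(H)\subset\mathcal D_q$ and $q_\alpha(\eta,\varphi)=\langle\eta,H\varphi\rangle$ for all $\eta\in\mathcal D_q$, $\varphi\in D(H)$. -/

import Mathlib

open MeasureTheory Filter Set Topology
open scoped ContDiff ENNReal ComplexConjugate

noncomputable section

namespace PairForm

/-- The configuration space `Ω = {(x, y) : x ≥ 0, y ≥ 0, |x - y| ≤ d}`. -/
def strip (d : ℝ) : Set (ℝ × ℝ) := {p | 0 ≤ p.1 ∧ 0 ≤ p.2 ∧ |p.1 - p.2| ≤ d}

/-- Lebesgue measure on `Ω`. -/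
abbrev stripMeasure (d : ℝ) : Measure (ℝ × ℝ) := volume.restrict (strip d)

/-- The complex Hilbert space `L²(Ω)`. -/
abbrev L2 (d : ℝ) : Type := Lp ℂ 2 (stripMeasure d)

/-- Lebesgue measure `dx` on the half-line `[0, ∞)`. -/
abbrev halfLine : Measure ℝ := volume.restrict (Ici 0)

/-! ### The symmetric subspace -/

theorem measurePreserving_swap (d : ℝ) :
    MeasurePreserving Prod.swap (stripMeasure d) (stripMeasure d) := by
  have h : MeasurePreserving (Prod.swap : ℝ × ℝ → ℝ × ℝ) volume volume :=
    Measure.measurePreserving_swap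
  have h2 := h.restrict_preimage_emb MeasurableEquiv.prodComm.measurableEmbedding (strip d)
  have h3 : Prod.swap ⁻¹' strip d = strip d := by
    ext p
    simp only [strip, mem_preimage, mem_ofPred_eq, Prod.fst_swap, Prod.snd_swap,
      abs_sub_comm p.2 p.1]
    tauto
  rwa [h3] at h2

/-- `L²ₛ(Ω)`: the functions in `L²(Ω)` with `φ(x, y) = φ(y, x)` almost everywhere. -/
def L2s (d : ℝ) : Submodule ℂ (L2 d) where
  carrier := {φ | ∀ᵐ p ∂stripMeasure d, φ p.swap = φ p}
  zero_mem' := by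
    have h0 := Lp.coeFn_zero ℂ 2 (stripMeasure d)
    have h1 := (measurePreserving_swap d).quasiMeasurePreserving.ae h0
    change ∀ᵐ p ∂stripMeasure d, (0 : L2 d) p.swap = (0 : L2 d) p
    filter_upwards [h0, h1] with p hp hq
    rw [hp, hq, Pi.zero_apply, Pi.zero_apply]
  add_mem' := by
    intro φ ψ hφ hψ
    have h0 := Lp.coeFn_add φ ψ
    have h1 := (measurePreserving_swap d).quasiMeasurePreserving.ae h0
    change ∀ᵐ p ∂stripMeasure d, (φ + ψ) p.swap = (φ + ψ) p
    filter_upwards [h0, h1, hφ, hψ] with p hp hq h2 h3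
    rw [hp, hq, Pi.add_apply, Pi.add_apply, h2, h3]
  smul_mem' := by
    intro c φ hφ
    have h0 := Lp.coeFn_smul c φ
    have h1 := (measurePreserving_swap d).quasiMeasurePreserving.ae h0
    change ∀ᵐ p ∂stripMeasure d, (c • φ) p.swap = (c • φ) p
    filter_upwards [h0, h1, hφ] with p hp hq h2
    rw [hp, hq, Pi.smul_apply, Pi.smul_apply, h2]

theorem isClosed_L2s (d : ℝ) : IsClosed (L2s d : Set (L2 d)) := by
  have h : (L2s d : Set (L2 d)) =
      {φ | Lp.compMeasurePreservingₗᵢ ℂ Prod.swap (measurePreserving_swap d) φ = φ} := by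
    ext φ
    change (∀ᵐ p ∂stripMeasure d, φ p.swap = φ p) ↔
      Lp.compMeasurePreserving Prod.swap (measurePreserving_swap d) φ = φ
    have h1 := Lp.coeFn_compMeasurePreserving φ (measurePreserving_swap d)
    rw [Lp.ext_iff]
    constructor
    · intro h2
      filter_upwards [h1, h2] with p hp hq
      rw [hp, Function.comp_apply, hq]
    · intro h2
      filter_upwards [h1, h2] with p hp hq
      rw [← hq, hp, Function.comp_apply]
  rw [h]
  exact isClosed_eq (LinearIsometry.continuous _) continuous_id

instance (d : ℝ) : CompleteSpace (L2s d) := (isClosed_L2s d).completeSpace_coe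

/-! ### Weak derivatives and the Sobolev space `H¹(Ω)` -/

/-- `g ∈ L²(Ω)` is the weak derivative of `φ ∈ L²(Ω)` in the direction `v`: integration by parts
holds against every smooth function with compact support in the interior of `Ω`. -/
def HasWeakDeriv (d : ℝ) (v : ℝ × ℝ) (φ g : L2 d) : Prop :=
  ∀ η : ℝ × ℝ → ℝ, ContDiff ℝ ∞ η → HasCompactSupport η → tsupport η ⊆ interior (strip d) →
    ∫ p in strip d, (fderiv ℝ η p v : ℂ) * φ p = -∫ p in strip d, (η p : ℂ) * g p

theorem integrable_mul_L2 {d : ℝ} {f : ℝ × ℝ → ℝ} (hf : Continuous f)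
    (hc : HasCompactSupport f) (φ : L2 d) :
    Integrable (fun p => (f p : ℂ) * φ p) (stripMeasure d) := by
  have h1 : MemLp (fun p => (f p : ℂ)) 2 (stripMeasure d) :=
    (Complex.continuous_ofReal.comp hf).memLp_of_hasCompactSupport
      (hc.comp_left (g := fun x : ℝ => (x : ℂ)) Complex.ofReal_zero)
  exact h1.integrable_mul (Lp.memLp φ)

theorem integral_mul_add {d : ℝ} {f : ℝ × ℝ → ℝ} (hf : Continuous f)
    (hc : HasCompactSupport f) (φ ψ : L2 d) :
    ∫ p in strip d, (f p : ℂ) * (φ + ψ : L2 d) p =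
      (∫ p in strip d, (f p : ℂ) * φ p) + ∫ p in strip d, (f p : ℂ) * ψ p := by
  rw [← integral_add (integrable_mul_L2 hf hc φ) (integrable_mul_L2 hf hc ψ)]
  refine integral_congr_ae ?_
  filter_upwards [Lp.coeFn_add φ ψ] with p hp
  rw [hp, Pi.add_apply, mul_add]

theorem integral_mul_smul {d : ℝ} (f : ℝ × ℝ → ℝ) (c : ℂ) (φ : L2 d) :
    ∫ p in strip d, (f p : ℂ) * (c • φ : L2 d) p = c * ∫ p in strip d, (f p : ℂ) * φ p := by
  rw [← integral_const_mul]
  refine integral_congr_ae ?_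
  filter_upwards [Lp.coeFn_smul c φ] with p hp
  simp only [hp, Pi.smul_apply, smul_eq_mul]
  ring

theorem HasWeakDeriv.zero (d : ℝ) (v : ℝ × ℝ) : HasWeakDeriv d v 0 0 := by
  intro η _ _ _
  have h (f : ℝ × ℝ → ℝ) : ∫ p in strip d, (f p : ℂ) * (0 : L2 d) p = 0 := by
    simpa using integral_mul_smul f 0 (0 : L2 d)
  rw [h (fun p => fderiv ℝ η p v), h η, neg_zero]

theorem HasWeakDeriv.add {d : ℝ} {v : ℝ × ℝ} {φ ψ g h : L2 d} (hφ : HasWeakDeriv d v φ g)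
    (hψ : HasWeakDeriv d v ψ h) : HasWeakDeriv d v (φ + ψ) (g + h) := by
  intro η h1 h2 h3
  have hd : Continuous (fun p => fderiv ℝ η p v) :=
    (h1.continuous_fderiv (by simp)).clm_apply continuous_const
  rw [integral_mul_add hd (h2.fderiv_apply ℝ v), integral_mul_add h1.continuous h2,
    hφ η h1 h2 h3, hψ η h1 h2 h3]
  ring

theorem HasWeakDeriv.smul {d : ℝ} {v : ℝ × ℝ} {φ g : L2 d} (c : ℂ) (hφ : HasWeakDeriv d v φ g) :
    HasWeakDeriv d v (c • φ) (c • g) := by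
  intro η h1 h2 h3
  rw [integral_mul_smul (fun p => fderiv ℝ η p v), integral_mul_smul η, hφ η h1 h2 h3]
  ring

/-- The Sobolev space `H¹(Ω)`. -/
def H1 (d : ℝ) : Submodule ℂ (L2 d) where
  carrier := {φ | (∃ g, HasWeakDeriv d (1, 0) φ g) ∧ ∃ g, HasWeakDeriv d (0, 1) φ g}
  zero_mem' := ⟨⟨0, .zero d _⟩, ⟨0, .zero d _⟩⟩
  add_mem' := by
    rintro φ ψ ⟨⟨g, hg⟩, ⟨h, hh⟩⟩ ⟨⟨g', hg'⟩, ⟨h', hh'⟩⟩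
    exact ⟨⟨_, hg.add hg'⟩, ⟨_, hh.add hh'⟩⟩
  smul_mem' := by
    rintro c φ ⟨⟨g, hg⟩, ⟨h, hh⟩⟩
    exact ⟨⟨_, hg.smul c⟩, ⟨_, hh.smul c⟩⟩

open Classical in
/-- The weak derivative of `φ` in the direction `v` (`0` if there is none). -/
def weakDeriv (d : ℝ) (v : ℝ × ℝ) (φ : L2 d) : L2 d :=
  if h : ∃ g, HasWeakDeriv d v φ g then h.choose else 0

/-! ### Traces -/

/-- The diagonal `x = y` of `Ω`, parametrised by `x ∈ [0, ∞)`. -/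
def diagonalLine (s : ℝ) : ℝ × ℝ := (s, s)

/-- The part `x - y = d` of `∂Ω_D`, parametrised by `[0, ∞)`. -/
def lowerLine (d s : ℝ) : ℝ × ℝ := (s + d, s)

/-- The part `y - x = d` of `∂Ω_D`, parametrised by `[0, ∞)`. -/
def upperLine (d s : ℝ) : ℝ × ℝ := (s, s + d)

/-- `τ ∈ L²(0, ∞)` is the trace of `φ ∈ H¹(Ω)` along the half-line `γ : [0, ∞) → Ω`: the trace
operator is the extension by continuity, from `H¹(Ω)` to `L²(0, ∞)`, of the restriction
`u ↦ u ∘ γ` of functions `u` that are smooth up to the boundary. -/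
def HasTrace (d : ℝ) (γ : ℝ → ℝ × ℝ) (φ : L2 d) (τ : Lp ℂ 2 halfLine) : Prop :=
  ∃ g h : L2 d, HasWeakDeriv d (1, 0) φ g ∧ HasWeakDeriv d (0, 1) φ h ∧
    ∃ u : ℕ → ℝ × ℝ → ℂ, (∀ n, ContDiff ℝ ∞ (u n)) ∧
      Tendsto (fun n => eLpNorm (fun p => u n p - φ p) 2 (stripMeasure d)) atTop (𝓝 0) ∧
      Tendsto (fun n => eLpNorm (fun p => fderiv ℝ (u n) p (1, 0) - g p) 2 (stripMeasure d))
        atTop (𝓝 0) ∧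
      Tendsto (fun n => eLpNorm (fun p => fderiv ℝ (u n) p (0, 1) - h p) 2 (stripMeasure d))
        atTop (𝓝 0) ∧
      Tendsto (fun n => eLpNorm (fun s => u n (γ s) - τ s) 2 halfLine) atTop (𝓝 0)

theorem tendsto_eLpNorm_add {X : Type} [MeasurableSpace X] {μ : Measure X}
    {a b : ℕ → X → ℂ} {f g : Lp ℂ 2 μ}
    (ha : ∀ n, AEStronglyMeasurable (a n) μ) (hb : ∀ n, AEStronglyMeasurable (b n) μ)
    (h1 : Tendsto (fun n => eLpNorm (fun p => a n p - f p) 2 μ) atTop (𝓝 0))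
    (h2 : Tendsto (fun n => eLpNorm (fun p => b n p - g p) 2 μ) atTop (𝓝 0)) :
    Tendsto (fun n => eLpNorm (fun p => (a n p + b n p) - (f + g : Lp ℂ 2 μ) p) 2 μ)
      atTop (𝓝 0) := by
  have h3 := h1.add h2
  rw [add_zero] at h3
  refine tendsto_of_tendsto_of_tendsto_of_le_of_le tendsto_const_nhds h3
    (fun _ => zero_le) fun n => ?_
  have h4 : (fun p => (a n p + b n p) - (f + g : Lp ℂ 2 μ) p) =ᵐ[μ]
      (fun p => a n p - f p) + fun p => b n p - g p := by
    filter_upwards [Lp.coeFn_add f g] with p hp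
    simp only [hp, Pi.add_apply]
    ring
  rw [eLpNorm_congr_ae h4]
  exact eLpNorm_add_le ((ha n).sub (Lp.aestronglyMeasurable f))
    ((hb n).sub (Lp.aestronglyMeasurable g)) (by norm_num)

theorem tendsto_eLpNorm_smul {X : Type} [MeasurableSpace X] {μ : Measure X}
    {a : ℕ → X → ℂ} {f : Lp ℂ 2 μ} (c : ℂ)
    (h1 : Tendsto (fun n => eLpNorm (fun p => a n p - f p) 2 μ) atTop (𝓝 0)) :
    Tendsto (fun n => eLpNorm (fun p => c * a n p - (c • f : Lp ℂ 2 μ) p) 2 μ)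
      atTop (𝓝 0) := by
  have h3 := ENNReal.Tendsto.const_mul (a := ‖c‖ₑ) h1 (Or.inr (by simp))
  rw [mul_zero] at h3
  refine h3.congr fun n => ?_
  rw [← eLpNorm_const_smul]
  refine eLpNorm_congr_ae ?_
  filter_upwards [Lp.coeFn_smul c f] with p hp
  simp only [hp, Pi.smul_apply, smul_eq_mul]
  ring

theorem HasTrace.zero (d : ℝ) (γ : ℝ → ℝ × ℝ) : HasTrace d γ 0 0 := by
  have key {X : Type} [MeasurableSpace X] (μ : Measure X) :
      Tendsto (fun _ : ℕ => eLpNorm (fun p => (0 : ℂ) - (0 : Lp ℂ 2 μ) p) 2 μ) atTop (𝓝 0) := by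
    have : eLpNorm (fun p => (0 : ℂ) - (0 : Lp ℂ 2 μ) p) 2 μ = 0 := by
      rw [← eLpNorm_zero (p := 2) (μ := μ) (ε := ℂ)]
      refine eLpNorm_congr_ae ?_
      filter_upwards [Lp.coeFn_zero ℂ 2 μ] with p hp
      rw [hp, Pi.zero_apply, sub_zero]
    rw [this]
    exact tendsto_const_nhds
  refine ⟨0, 0, .zero d _, .zero d _, fun _ _ => 0, fun _ => contDiff_const, key _, ?_, ?_, key _⟩
  all_goals simpa using key (stripMeasure d)

theorem HasTrace.add {d : ℝ} {γ : ℝ → ℝ × ℝ} (hγ : Continuous γ) {φ ψ : L2 d}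
    {σ τ : Lp ℂ 2 halfLine} (h1 : HasTrace d γ φ σ) (h2 : HasTrace d γ ψ τ) :
    HasTrace d γ (φ + ψ) (σ + τ) := by
  obtain ⟨g, h, hg, hh, u, hu, a1, a2, a3, a4⟩ := h1
  obtain ⟨g', h', hg', hh', w, hw, b1, b2, b3, b4⟩ := h2
  have hm {f : ℝ × ℝ → ℂ} (hf : ContDiff ℝ ∞ f) (v : ℝ × ℝ) :
      Continuous (fun p => fderiv ℝ f p v) :=
    (hf.continuous_fderiv (by simp)).clm_apply continuous_const
  have hd (n : ℕ) (p v : ℝ × ℝ) :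
      fderiv ℝ (fun q => u n q + w n q) p v = fderiv ℝ (u n) p v + fderiv ℝ (w n) p v := by
    rw [fderiv_fun_add ((hu n).differentiable (by simp) p) ((hw n).differentiable (by simp) p)]
    rfl
  refine ⟨g + g', h + h', hg.add hg', hh.add hh', fun n p => u n p + w n p,
    fun n => (hu n).add (hw n), ?_, ?_, ?_, ?_⟩
  · exact tendsto_eLpNorm_add (fun n => (hu n).continuous.aestronglyMeasurable)
      (fun n => (hw n).continuous.aestronglyMeasurable) a1 b1
  · simp only [hd]
    exact tendsto_eLpNorm_add (fun n => (hm (hu n) _).aestronglyMeasurable)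
      (fun n => (hm (hw n) _).aestronglyMeasurable) a2 b2
  · simp only [hd]
    exact tendsto_eLpNorm_add (fun n => (hm (hu n) _).aestronglyMeasurable)
      (fun n => (hm (hw n) _).aestronglyMeasurable) a3 b3
  · exact tendsto_eLpNorm_add (fun n => ((hu n).continuous.comp hγ).aestronglyMeasurable)
      (fun n => ((hw n).continuous.comp hγ).aestronglyMeasurable) a4 b4

theorem HasTrace.smul {d : ℝ} {γ : ℝ → ℝ × ℝ} {φ : L2 d} {τ : Lp ℂ 2 halfLine} (c : ℂ)
    (h1 : HasTrace d γ φ τ) : HasTrace d γ (c • φ) (c • τ) := by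
  obtain ⟨g, h, hg, hh, u, hu, a1, a2, a3, a4⟩ := h1
  have hd (n : ℕ) (p v : ℝ × ℝ) :
      fderiv ℝ (fun q => c * u n q) p v = c * fderiv ℝ (u n) p v := by
    rw [fderiv_const_mul ((hu n).differentiable (by simp) p)]
    rfl
  refine ⟨c • g, c • h, hg.smul c, hh.smul c, fun n p => c * u n p,
    fun n => contDiff_const.mul (hu n), ?_, ?_, ?_, ?_⟩
  · exact tendsto_eLpNorm_smul c a1
  · simp only [hd]
    exact tendsto_eLpNorm_smul c a2
  · simp only [hd]
    exact tendsto_eLpNorm_smul c a3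
  · exact tendsto_eLpNorm_smul c a4

open Classical in
/-- The trace `x ↦ φ(x, x)` on the diagonal (`0` if there is none). -/
def diagonalTrace (d : ℝ) (φ : L2 d) : Lp ℂ 2 halfLine :=
  if h : ∃ τ, HasTrace d diagonalLine φ τ then h.choose else 0

/-! ### The form -/

/-- The form domain: all symmetric `φ ∈ H¹(Ω)` with vanishing trace on
`∂Ω_D = {(x, y) ∈ Ω : |x - y| = d}`. -/
def formDomain (d : ℝ) : Submodule ℂ (L2s d) where
  carrier := {φ | (φ : L2 d) ∈ H1 d ∧ HasTrace d (lowerLine d) φ 0 ∧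
    HasTrace d (upperLine d) φ 0}
  zero_mem' := ⟨(H1 d).zero_mem, HasTrace.zero d _, HasTrace.zero d _⟩
  add_mem' := by
    rintro φ ψ ⟨h1, h2, h3⟩ ⟨k1, k2, k3⟩
    have c1 : Continuous (lowerLine d) := by unfold lowerLine; fun_prop
    have c2 : Continuous (upperLine d) := by unfold upperLine; fun_prop
    exact ⟨(H1 d).add_mem h1 k1, by simpa using h2.add c1 k2, by simpa using h3.add c2 k3⟩
  smul_mem' := by
    rintro c φ ⟨h1, h2, h3⟩
    exact ⟨(H1 d).smul_mem c h1, by simpa using h2.smul c, by simpa using h3.smul c⟩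

/-- `q_α[φ] = ∫_Ω |∇φ|² + α ∫ |φ(x, x)|² dx`. -/
def quadForm (d α : ℝ) (φ : formDomain d) : ℝ :=
  (∫ p in strip d, (‖weakDeriv d (1, 0) φ p‖ ^ 2 + ‖weakDeriv d (0, 1) φ p‖ ^ 2)) +
    α * ∫ x in Ici (0 : ℝ), ‖diagonalTrace d φ x‖ ^ 2

/-- The sesquilinear form of `q_α`, conjugate-linear in the first variable. -/
def sesqForm (d α : ℝ) (φ ψ : formDomain d) : ℂ :=
  (∫ p in strip d, (conj (weakDeriv d (1, 0) φ p) * weakDeriv d (1, 0) ψ p +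
      conj (weakDeriv d (0, 1) φ p) * weakDeriv d (0, 1) ψ p)) +
    (α : ℂ) * ∫ x in Ici (0 : ℝ), conj (diagonalTrace d φ x) * diagonalTrace d ψ x

end PairForm

/-! ### Forms in a Hilbert space -/

/-- A real quadratic form `q` with domain `D` is bounded from below: `q[u] ≥ m ‖u‖²` on `D`. -/
def FormBoundedBelow {E : Type*} [NormedAddCommGroup E] [InnerProductSpace ℂ E]
    (D : Submodule ℂ E) (q : D → ℝ) : Prop :=
  ∃ m : ℝ, ∀ u : D, m * ‖(u : E)‖ ^ 2 ≤ q u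

/-- A (semibounded) quadratic form `q` with domain `D` is closed: if `uₙ ∈ D`, `uₙ → x` in `E` and
`q[uₙ - uₘ] → 0`, then `x ∈ D` and `q[uₙ - x] → 0`. -/
def FormClosed {E : Type*} [NormedAddCommGroup E] [InnerProductSpace ℂ E]
    (D : Submodule ℂ E) (q : D → ℝ) : Prop :=
  ∀ (u : ℕ → D) (x : E), Tendsto (fun n => (u n : E)) atTop (𝓝 x) →
    Tendsto (fun k : ℕ × ℕ => q (u k.1 - u k.2)) atTop (𝓝 0) →
    ∃ hx : x ∈ D, Tendsto (fun n => q (u n - ⟨x, hx⟩)) atTop (𝓝 0)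

/-- `D(H) ⊆ D` and `a(η, φ) = ⟨η, H φ⟩` for all `φ ∈ D(H)`, `η ∈ D`. -/
def FormRepresentedBy {E : Type*} [NormedAddCommGroup E] [InnerProductSpace ℂ E]
    (D : Submodule ℂ E) (a : D → D → ℂ) (H : E →ₗ.[ℂ] E) : Prop :=
  ∀ φ : H.domain, ∃ hφ : (φ : E) ∈ D, ∀ η : D, a η ⟨φ, hφ⟩ = inner ℂ (η : E) (H φ)

/-- `H` is the operator associated with the form `a`: `φ ∈ D(H)` with `H φ = ψ` if and only if
`φ ∈ D` and `a(η, φ) = ⟨η, ψ⟩` for all `η ∈ D`. -/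
def FormAssociatedOperator {E : Type*} [NormedAddCommGroup E] [InnerProductSpace ℂ E]
    (D : Submodule ℂ E) (a : D → D → ℂ) (H : E →ₗ.[ℂ] E) : Prop :=
  ∀ φ ψ : E, (∃ hφ : φ ∈ H.domain, H ⟨φ, hφ⟩ = ψ) ↔
    ∃ hφ : φ ∈ D, ∀ η : D, a η ⟨φ, hφ⟩ = inner ℂ (η : E) ψ

end

/-! The form is the square of a map: for `α ≥ 0`, `q_α(η, φ) = ⟨A η, A φ⟩` with `A φ = (∂₁φ, ∂₂φ, √α
φ(x, x))` (`formMap`). It is therefore nonnegative, and its closedness amounts to closedness of the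
graph of `A`. The representation theorem is proved for any such map with dense domain: projecting
`(f, 0)` orthogonally onto the closed graph of `A` solves `(H + 1) u = f`. A symmetric operator for
which `H + 1` is onto is self-adjoint, and self-adjoint operators have no proper self-adjoint
extensions, which gives uniqueness.

The analysis lies in the traces. Integrating along segments of length `d` that cross half of the
strip bounds the restriction of a smooth function to each of the three half-lines by its `H¹` norm
(`eLpNorm_restrict_le`). Uniqueness of traces follows by linearity. Existence also needs functions
smooth up to the boundary to be dense in `H¹(Ω)` (`exists_smooth_approx`). Here convexity of the
strip helps: the average of `φ` over the points `(1 - t) p + t w`, with `w` distributed in the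
interior, samples `φ` only inside the strip, is smooth on the whole plane, and commutes with weak
differentiation up to the factor `1 - t`.

Closedness (`formClosed_formMap`) then follows because weak derivatives pass to `L²` limits and
traces are continuous in the `H¹` norm. Density (`dense_formDomain`) follows from symmetrised test
functions. -/

/-! ### The operator of a closed form -/

section FormOperator

variable {E K : Type*} [NormedAddCommGroup E] [InnerProductSpace ℂ E]
  [NormedAddCommGroup K] [InnerProductSpace ℂ K]

/-- The graph `{(φ, ψ) : φ ∈ D, ⟨A η, A φ⟩ = ⟨η, ψ⟩ for all η ∈ D}` of the operator associated with
the form `⟨A η, A φ⟩`. -/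
def formGraph (D : Submodule ℂ E) (A : D →ₗ[ℂ] K) : Submodule ℂ (E × E) where
  carrier := {p | ∃ h : p.1 ∈ D, ∀ η : D, inner ℂ (A η) (A ⟨p.1, h⟩) = inner ℂ (η : E) p.2}
  zero_mem' := by
    refine ⟨D.zero_mem, fun η => ?_⟩
    have : (⟨(0 : E × E).1, D.zero_mem⟩ : D) = 0 := rfl
    rw [this, map_zero, inner_zero_right, Prod.snd_zero, inner_zero_right]
  add_mem' := by
    rintro p q ⟨h, hp⟩ ⟨k, hq⟩
    refine ⟨D.add_mem h k, fun η => ?_⟩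
    have : (⟨(p + q).1, D.add_mem h k⟩ : D) = ⟨p.1, h⟩ + ⟨q.1, k⟩ := rfl
    rw [this, map_add, inner_add_right, Prod.snd_add, inner_add_right, hp, hq]
  smul_mem' := by
    rintro c p ⟨h, hp⟩
    refine ⟨D.smul_mem c h, fun η => ?_⟩
    have : (⟨(c • p).1, D.smul_mem c h⟩ : D) = c • ⟨p.1, h⟩ := rfl
    rw [this, map_smul, inner_smul_right, Prod.smul_snd, inner_smul_right, hp]

variable {D : Submodule ℂ E} {A : D →ₗ[ℂ] K}

theorem formGraph_symm {p q : E × E} (hp : p ∈ formGraph D A) (hq : q ∈ formGraph D A) :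
    inner ℂ p.2 q.1 = inner ℂ p.1 q.2 := by
  obtain ⟨h, hp⟩ := hp
  obtain ⟨k, hq⟩ := hq
  rw [← inner_conj_symm, ← hp ⟨q.1, k⟩, inner_conj_symm, hq ⟨p.1, h⟩]

/-- Density of `D` is what makes the value `H φ` determined by the form. -/
theorem formGraph_functional (hD : Dense (D : Set E)) (x : E × E)
    (hx : x ∈ formGraph D A) (hx0 : x.1 = 0) : x.2 = 0 := by
  obtain ⟨h, hx⟩ := hx
  refine hD.eq_zero_of_inner_right ℂ fun v hv => ?_
  have : (⟨x.1, h⟩ : D) = 0 := Subtype.ext hx0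
  rw [← hx ⟨v, hv⟩, this, map_zero, inner_zero_right]

theorem formGraph_toLinearPMap_graph (hD : Dense (D : Set E)) :
    (formGraph D A).toLinearPMap.graph = formGraph D A :=
  Submodule.toLinearPMap_graph_eq _ (formGraph_functional hD)

/-- The graph of `A`, in the Hilbert sum. -/
def graphWithLp (D : Submodule ℂ E) (A : D →ₗ[ℂ] K) : Submodule ℂ (WithLp 2 (E × K)) :=
  LinearMap.range ((WithLp.linearEquiv 2 ℂ (E × K)).symm.toLinearMap ∘ₗ (D.subtype.prod A))

/-- Convergence of `A uₙ` makes `q[uₙ - uₘ]` tend to `0`, so closedness of the form places the limit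
of `uₙ` in `D` and identifies the limit of `A uₙ`. -/
theorem isClosed_graphWithLp (hc : FormClosed D fun u => ‖A u‖ ^ 2) :
    IsClosed (graphWithLp D A : Set (WithLp 2 (E × K))) := by
  refine isClosed_of_closure_subset fun z hz => ?_
  obtain ⟨y, hy, hlim⟩ := mem_closure_iff_seq_limit.1 hz
  choose u hu using hy
  have h1 : Tendsto (fun n => (u n : E)) atTop (𝓝 z.fst) := by
    have := ((WithLp.continuous_fst 2 E K).tendsto z).comp hlim
    refine this.congr fun n => ?_
    rw [Function.comp_apply, ← hu n]
    rfl
  have h2 : Tendsto (fun n => A (u n)) atTop (𝓝 z.snd) := by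
    have := ((WithLp.continuous_snd 2 E K).tendsto z).comp hlim
    refine this.congr fun n => ?_
    rw [Function.comp_apply, ← hu n]
    rfl
  obtain ⟨hz1, h4⟩ := hc u z.fst h1 (by
    have h3 : Tendsto (fun k : ℕ × ℕ => A (u k.1) - A (u k.2)) atTop (𝓝 (z.snd - z.snd)) := by
      rw [← prod_atTop_atTop_eq]
      exact (h2.comp tendsto_fst).sub (h2.comp tendsto_snd)
    rw [sub_self] at h3
    have := (h3.norm).pow 2
    simpa using this)
  have h5 : Tendsto (fun n => A (u n)) atTop (𝓝 (A ⟨z.fst, hz1⟩)) := by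
    rw [tendsto_iff_norm_sub_tendsto_zero]
    have := h4.sqrt
    simpa [Real.sqrt_sq] using this
  refine ⟨⟨z.fst, hz1⟩, ?_⟩
  have h6 := tendsto_nhds_unique h2 h5
  apply (WithLp.linearEquiv 2 ℂ (E × K)).injective
  exact Prod.ext rfl h6.symm

/-! ### Surjectivity of `H + 1` and self-adjointness -/

variable [CompleteSpace E] [CompleteSpace K]

/-- `H + 1` is onto. -/
theorem exists_mem_formGraph (hc : FormClosed D fun u => ‖A u‖ ^ 2) (f : E) :
    ∃ u ∈ D, (u, f - u) ∈ formGraph D A := by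
  have hcl := isClosed_graphWithLp hc
  have : CompleteSpace (graphWithLp D A) := hcl.completeSpace_coe
  -- The projection of `(f, 0)` onto the graph is some `(u, A u)`. The residual `(f - u, -A u)` is
  -- orthogonal to every `(η, A η)`, which is the equation `⟨A η, A u⟩ = ⟨η, f - u⟩`.
  obtain ⟨u, hu⟩ := ((graphWithLp D A).orthogonalProjectionOnto (WithLp.toLp 2 (f, (0 : K)))).2
  refine ⟨u, u.2, u.2, fun η => ?_⟩
  have h := (graphWithLp D A).starProjection_inner_eq_zero (WithLp.toLp 2 (f, (0 : K)))
    (((WithLp.linearEquiv 2 ℂ (E × K)).symm.toLinearMap ∘ₗ (D.subtype.prod A)) η) ⟨η, rfl⟩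
  rw [Submodule.starProjection_apply, ← hu, ← inner_conj_symm, map_eq_zero,
    WithLp.prod_inner_apply] at h
  have h' : inner ℂ (η : E) (f - u) + inner ℂ (A η) (0 - A u) = 0 := h
  rw [zero_sub, inner_neg_right, ← sub_eq_add_neg, sub_eq_zero] at h'
  exact h'.symm

/-- If `x` is orthogonal to the domain, solve `(H + 1) u = x`. Testing with `u` itself gives `‖A u‖²
= ⟨u, x⟩ - ‖u‖² = -‖u‖²`, so `u = 0`; then `x` is orthogonal to the dense set `D`. -/
theorem dense_formGraph_domain (hD : Dense (D : Set E)) (hc : FormClosed D fun u => ‖A u‖ ^ 2) :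
    Dense ((formGraph D A).toLinearPMap.domain : Set E) := by
  rw [Submodule.dense_iff_topologicalClosure_eq_top, Submodule.topologicalClosure_eq_top_iff,
    Submodule.eq_bot_iff]
  intro x hx
  obtain ⟨u, hu, hg⟩ := exists_mem_formGraph hc x
  have hud : u ∈ (formGraph D A).toLinearPMap.domain := by
    have := hg
    rw [← formGraph_toLinearPMap_graph hD] at this
    exact LinearPMap.mem_domain_of_mem_graph this
  have h1 : inner ℂ u x = 0 := (Submodule.mem_orthogonal _ x).1 hx u hud
  obtain ⟨h, hg'⟩ := hg
  have h2 := hg' ⟨u, hu⟩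
  rw [inner_sub_right, h1, zero_sub, inner_self_eq_norm_sq_to_K, inner_self_eq_norm_sq_to_K] at h2
  have h3 : ‖A ⟨u, hu⟩‖ ^ 2 = - ‖u‖ ^ 2 := by exact_mod_cast h2
  have hu0 : u = 0 := by
    rw [← norm_eq_zero]
    nlinarith [sq_nonneg ‖A ⟨u, hu⟩‖, norm_nonneg u]
  subst hu0
  refine hD.eq_zero_of_inner_right ℂ fun v hv => ?_
  have h4 := hg' ⟨v, hv⟩
  have h5 : (⟨0, h⟩ : D) = 0 := rfl
  rw [h5, map_zero, inner_zero_right] at h4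
  simpa using h4.symm

/-- Symmetry gives `H ≤ H*`. For `x` in the domain of `H*`, choose `y` in the domain of `H` with `(H
+ 1) y = (H* + 1) x`. Then `x - y` is orthogonal to the range of `H + 1`, which is everything, so `x
= y`. -/
theorem isSelfAdjoint_formGraph (hD : Dense (D : Set E))
    (hc : FormClosed D fun u => ‖A u‖ ^ 2) :
    IsSelfAdjoint (formGraph D A).toLinearPMap := by
  have hdom := dense_formGraph_domain hD hc
  set H := (formGraph D A).toLinearPMap with hH
  have hgr : H.graph = formGraph D A := formGraph_toLinearPMap_graph hD
  have hmem (x : H.domain) : ((x : E), H x) ∈ formGraph D A := hgr ▸ H.mem_graph x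
  have hle : H ≤ H.adjoint :=
    LinearPMap.IsFormalAdjoint.le_adjoint hdom fun x y => formGraph_symm (hmem x) (hmem y)
  rw [LinearPMap.isSelfAdjoint_def]
  refine (LinearPMap.eq_of_le_of_domain_eq hle (le_antisymm hle.1 fun x hx => ?_)).symm
  obtain ⟨y, hy, hg⟩ := exists_mem_formGraph hc (H.adjoint ⟨x, hx⟩ + x)
  have hyd : y ∈ H.domain := LinearPMap.mem_domain_of_mem_graph (hgr ▸ hg)
  suffices x = y from this ▸ hyd
  -- Write `f = (H + 1) z` and move `H` across, using the adjoint relation for `x` and symmetry for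
  -- `y`.
  have key (f : E) : inner ℂ f (x - y) = 0 := by
    obtain ⟨z, hz, hzg⟩ := exists_mem_formGraph hc f
    have h1 := formGraph_symm hzg hg
    have hzg' : (z, f - z) ∈ H.graph := hgr ▸ hzg
    obtain ⟨w, hw1, hw2⟩ := (LinearPMap.mem_graph_iff _).1 hzg'
    have h2 := (LinearPMap.adjoint_isFormalAdjoint hdom).symm w ⟨x, hx⟩
    simp only at hw1 hw2 h1
    rw [hw1, hw2] at h2
    simp only [inner_sub_left, inner_sub_right, inner_add_right] at h1 h2 ⊢
    linear_combination h2 - h1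
  exact sub_eq_zero.1 (inner_self_eq_zero.1 (key (x - y)))

/-- For uniqueness, a represented `H'` has its graph inside `formGraph`, so `H' ≤ H`. Passing to
adjoints reverses the inclusion, and both operators are self-adjoint. -/
theorem exists_formAssociatedOperator (hD : Dense (D : Set E))
    (hc : FormClosed D fun u => ‖A u‖ ^ 2) {a : D → D → ℂ}
    (ha : ∀ η φ, a η φ = inner ℂ (A η) (A φ)) :
    ∃ H : E →ₗ.[ℂ] E, IsSelfAdjoint H ∧ FormAssociatedOperator D a H ∧
      ∀ H' : E →ₗ.[ℂ] E, IsSelfAdjoint H' → FormRepresentedBy D a H' → H' = H := by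
  have hsa := isSelfAdjoint_formGraph hD hc
  have hgr := formGraph_toLinearPMap_graph (A := A) hD
  set H := (formGraph D A).toLinearPMap
  refine ⟨H, hsa, fun φ ψ => ?_, fun H' hsa' hr => ?_⟩
  · have h1 : (∃ hφ : φ ∈ H.domain, H ⟨φ, hφ⟩ = ψ) ↔ (φ, ψ) ∈ H.graph := by
      rw [LinearPMap.mem_graph_iff]
      constructor
      · rintro ⟨h, rfl⟩
        exact ⟨⟨φ, h⟩, rfl, rfl⟩
      · rintro ⟨⟨y, hy⟩, h1, h2⟩
        simp only at h1 h2
        subst h1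
        exact ⟨hy, h2⟩
    rw [h1, hgr]
    simp only [ha]
    rfl
  · have hle : H' ≤ H := by
      refine LinearPMap.le_of_le_graph fun x hx => ?_
      rw [hgr]
      obtain ⟨y, h1, h2⟩ := (LinearPMap.mem_graph_iff _).1 hx
      obtain ⟨h3, h4⟩ := hr y
      refine ⟨h1 ▸ h3, fun η => ?_⟩
      rw [← ha, ← h2, ← h4]
      congr 2
      exact h1.symm
    refine le_antisymm hle ?_
    have h1 : H'.IsFormalAdjoint H := fun x y => by
      have hx := hle.1 x.2
      have h2 : H' x = H ⟨x, hx⟩ := hle.2 rfl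
      have h3 := LinearPMap.adjoint_isFormalAdjoint hsa.dense_domain
      rw [LinearPMap.isSelfAdjoint_def.1 hsa] at h3
      rw [h2]
      exact h3 ⟨x, hx⟩ y
    have h2 := h1.le_adjoint hsa'.dense_domain
    rwa [LinearPMap.isSelfAdjoint_def.1 hsa'] at h2

end FormOperator

namespace PairForm

/-! ### Geometry of the strip -/

theorem isClosed_strip (d : ℝ) : IsClosed (strip d) := by
  have h : Continuous fun p : ℝ × ℝ => |p.1 - p.2| := by fun_prop
  exact (isClosed_le continuous_const continuous_fst).inter
    ((isClosed_le continuous_const continuous_snd).inter (isClosed_le h continuous_const))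

theorem convex_strip (d : ℝ) : Convex ℝ (strip d) := by
  rintro ⟨x, y⟩ ⟨h1, h2, h3⟩ ⟨x', y'⟩ ⟨k1, k2, k3⟩ a b ha hb hab
  simp only [abs_le] at h3 k3
  simp only [strip, mem_ofPred_eq, Prod.smul_mk, Prod.mk_add_mk, smul_eq_mul, abs_le] at *
  refine ⟨by positivity, by positivity, ?_, ?_⟩ <;> nlinarith

theorem ae_mem_interior_strip (d : ℝ) : ∀ᵐ p ∂stripMeasure d, p ∈ interior (strip d) := by
  rw [ae_restrict_iff' (isClosed_strip d).measurableSet]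
  have h : ∀ᵐ p : ℝ × ℝ, p ∉ frontier (strip d) := by
    rw [ae_iff]
    simpa using (convex_strip d).addHaar_frontier volume
  filter_upwards [h] with p hp hps
  by_contra hn
  exact hp ⟨subset_closure hps, hn⟩

theorem interior_strip_nonempty {d : ℝ} (hd : 0 < d) : (interior (strip d)).Nonempty := by
  refine ⟨(1, 1), mem_interior.2 ⟨{p | 0 < p.1 ∧ 0 < p.2 ∧ |p.1 - p.2| < d}, ?_, ?_, by simpa⟩⟩
  · rintro p ⟨h1, h2, h3⟩
    exact ⟨h1.le, h2.le, h3.le⟩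
  · have h : Continuous fun p : ℝ × ℝ => |p.1 - p.2| := by fun_prop
    exact (isOpen_lt continuous_const continuous_fst).inter
      ((isOpen_lt continuous_const continuous_snd).inter (isOpen_lt h continuous_const))

/-- An interior point can be moved horizontally in both directions within the strip. This serves to
show that functions supported in the interior vanish on the Dirichlet half-lines. -/
theorem abs_sub_lt_of_mem_interior_strip {d : ℝ} {p : ℝ × ℝ} (hp : p ∈ interior (strip d)) :
    |p.1 - p.2| < d := by
  have hn := mem_interior_iff_mem_nhds.1 hp
  have h1 : Tendsto (fun t : ℝ => (p.1 + t, p.2)) (𝓝 0) (𝓝 p) := by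
    have : Continuous (fun t : ℝ => (p.1 + t, p.2)) := by fun_prop
    simpa using this.tendsto 0
  obtain ⟨ε, hε, h2⟩ := Metric.eventually_nhds_iff.1 (h1.eventually hn)
  have h3 := (h2 (y := ε / 2) (by rw [dist_zero_right, Real.norm_of_nonneg] <;> linarith)).2.2
  have h4 := (h2 (y := -(ε / 2)) (by
    rw [dist_zero_right, norm_neg, Real.norm_of_nonneg] <;> linarith)).2.2
  rw [abs_le] at h3 h4
  rw [abs_lt]
  constructor <;> linarith [h3.1, h3.2, h4.1, h4.2]

/-! ### Weak derivatives -/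

/-- A continuous compactly supported function as an element of `L²(Ω)`. -/
noncomputable def toL2 (d : ℝ) {f : ℝ × ℝ → ℂ} (hf : Continuous f) (hc : HasCompactSupport f) :
    L2 d :=
  (hf.memLp_of_hasCompactSupport (p := 2) (μ := stripMeasure d) hc).toLp f

theorem coeFn_toL2 (d : ℝ) {f : ℝ × ℝ → ℂ} (hf : Continuous f) (hc : HasCompactSupport f) :
    toL2 d hf hc =ᵐ[stripMeasure d] f :=
  MemLp.coeFn_toLp _

theorem inner_toL2_ofReal {d : ℝ} {f : ℝ × ℝ → ℝ} (hf : Continuous fun p => (f p : ℂ))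
    (hc : HasCompactSupport fun p => (f p : ℂ)) (φ : L2 d) :
    inner ℂ (toL2 d hf hc) φ = ∫ p in strip d, (f p : ℂ) * φ p := by
  rw [L2.inner_def]
  refine integral_congr_ae ?_
  filter_upwards [coeFn_toL2 d hf hc] with p hp
  rw [hp, RCLike.inner_apply, Complex.conj_ofReal, mul_comm]

theorem hasCompactSupport_ofReal {X : Type*} [TopologicalSpace X] {f : X → ℝ}
    (hc : HasCompactSupport f) : HasCompactSupport fun p => (f p : ℂ) :=
  hc.comp_left (g := fun x : ℝ => (x : ℂ)) Complex.ofReal_zero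

/-- Elements of `L²(Ω)` are determined by their integrals against test functions. -/
theorem eq_zero_of_forall_test {d : ℝ} {φ : L2 d}
    (h : ∀ η : ℝ × ℝ → ℝ, ContDiff ℝ ∞ η → HasCompactSupport η →
      tsupport η ⊆ interior (strip d) → ∫ p in strip d, (η p : ℂ) * φ p = 0) : φ = 0 := by
  have h1 : ∀ᵐ p ∂stripMeasure d, p ∈ interior (strip d) → φ p = 0 := by
    refine isOpen_interior.ae_eq_zero_of_integral_contDiff_smul_eq_zero ?_ ?_
    · exact ((Lp.memLp φ).locallyIntegrable (by norm_num)).locallyIntegrableOn _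
    · intro η h1 h2 h3
      simpa using h η h1 h2 h3
  refine Lp.ext ?_
  filter_upwards [h1, ae_mem_interior_strip d, Lp.coeFn_zero ℂ 2 (stripMeasure d)] with p hp hq h0
  rw [h0, hp hq, Pi.zero_apply]

theorem HasWeakDeriv.unique {d : ℝ} {v : ℝ × ℝ} {φ g h : L2 d} (hg : HasWeakDeriv d v φ g)
    (hh : HasWeakDeriv d v φ h) : g = h := by
  rw [← sub_eq_zero]
  refine eq_zero_of_forall_test fun η h1 h2 h3 => ?_
  have e1 := hg η h1 h2 h3
  rw [hh η h1 h2 h3] at e1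
  have h4 : g - h = g + (-1 : ℂ) • h := by simp [sub_eq_add_neg]
  rw [h4, integral_mul_add h1.continuous h2, integral_mul_smul η]
  linear_combination e1

theorem weakDeriv_eq {d : ℝ} {v : ℝ × ℝ} {φ g : L2 d} (hg : HasWeakDeriv d v φ g) :
    weakDeriv d v φ = g := by
  have h : ∃ g, HasWeakDeriv d v φ g := ⟨g, hg⟩
  rw [weakDeriv, dif_pos h]
  exact h.choose_spec.unique hg

/-- In terms of inner products with fixed vectors, the condition visibly passes to `L²` limits. -/
theorem hasWeakDeriv_iff_inner {d : ℝ} {v : ℝ × ℝ} {φ g : L2 d} :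
    HasWeakDeriv d v φ g ↔ ∀ η : ℝ × ℝ → ℝ, ∀ h1 : ContDiff ℝ ∞ η, ∀ h2 : HasCompactSupport η,
      tsupport η ⊆ interior (strip d) →
      inner ℂ (toL2 d (f := fun p => (fderiv ℝ η p v : ℂ))
        (Complex.continuous_ofReal.comp
          ((h1.continuous_fderiv (by simp)).clm_apply continuous_const))
        (hasCompactSupport_ofReal (h2.fderiv_apply ℝ v))) φ =
      -inner ℂ (toL2 d (f := fun p => (η p : ℂ)) (Complex.continuous_ofReal.comp h1.continuous)
        (hasCompactSupport_ofReal h2)) g := by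
  simp only [inner_toL2_ofReal]
  rfl

theorem HasWeakDeriv.of_tendsto {d : ℝ} {v : ℝ × ℝ} {ι : Type*} {l : Filter ι} [l.NeBot]
    {φ g : ι → L2 d} {φ' g' : L2 d}
    (h : ∀ n, HasWeakDeriv d v (φ n) (g n)) (hφ : Tendsto φ l (𝓝 φ')) (hg : Tendsto g l (𝓝 g')) :
    HasWeakDeriv d v φ' g' := by
  rw [hasWeakDeriv_iff_inner]
  intro η h1 h2 h3
  refine tendsto_nhds_unique (tendsto_const_nhds.inner hφ)
    ((tendsto_const_nhds.inner hg).neg.congr fun n => ?_)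
  exact (hasWeakDeriv_iff_inner.1 (h n) η h1 h2 h3).symm

/-- Classical derivatives of smooth functions are weak derivatives. -/
theorem hasWeakDeriv_of_contDiff {d : ℝ} {v : ℝ × ℝ} {u : ℝ × ℝ → ℂ} (hu : ContDiff ℝ ∞ u)
    {φ g : L2 d} (hφ : φ =ᵐ[stripMeasure d] u)
    (hg : g =ᵐ[stripMeasure d] fun p => fderiv ℝ u p v) : HasWeakDeriv d v φ g := by
  intro η h1 h2 h3
  have hη : ContDiff ℝ ∞ fun p => (η p : ℂ) := Complex.ofRealCLM.contDiff.comp h1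
  have hη2 := hasCompactSupport_ofReal h2
  have hd (p : ℝ × ℝ) : fderiv ℝ (fun p => (η p : ℂ)) p v = (fderiv ℝ η p v : ℂ) := by
    have := (Complex.ofRealCLM.hasFDerivAt.comp p
      (h1.differentiable (by simp) p).hasFDerivAt).fderiv
    change fderiv ℝ (Complex.ofRealCLM ∘ η) p v = _
    rw [this]
    rfl
  -- Since `η` is supported inside the strip, the integrals can be taken over the whole plane, where
  -- integration by parts has no boundary term.
  have e0 (f : ℝ × ℝ → ℝ) (w : ℝ × ℝ → ℂ) (hf : ∀ p, p ∉ strip d → f p = 0) :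
      ∫ p in strip d, (f p : ℂ) * w p = ∫ p, (f p : ℂ) * w p := by
    refine setIntegral_eq_integral_of_forall_compl_eq_zero fun p hp => ?_
    rw [hf p hp, Complex.ofReal_zero, zero_mul]
  have hs1 (p : ℝ × ℝ) (hp : p ∉ strip d) : p ∉ tsupport η := fun h => hp (interior_subset (h3 h))
  have e1 : ∫ p in strip d, (fderiv ℝ η p v : ℂ) * φ p = ∫ p, (fderiv ℝ η p v : ℂ) * u p := by
    rw [← e0 (fun p => fderiv ℝ η p v) u fun p hp => by
      rw [fderiv_of_notMem_tsupport ℝ (hs1 p hp)]; rfl]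
    refine integral_congr_ae ?_
    filter_upwards [hφ] with p hp
    rw [hp]
  have e2 : ∫ p in strip d, (η p : ℂ) * g p = ∫ p, (η p : ℂ) * fderiv ℝ u p v := by
    rw [← e0 η _ fun p hp => image_eq_zero_of_notMem_tsupport (hs1 p hp)]
    refine integral_congr_ae ?_
    filter_upwards [hg] with p hp
    rw [hp]
  have hcu : Continuous fun p => fderiv ℝ u p v :=
    (hu.continuous_fderiv (by simp)).clm_apply continuous_const
  have hcη : Continuous fun p => fderiv ℝ (fun p => (η p : ℂ)) p v :=
    (hη.continuous_fderiv (by simp)).clm_apply continuous_const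
  have e3 := integral_mul_fderiv_eq_neg_fderiv_mul_of_integrable (μ := volume)
    (f := fun p => (η p : ℂ)) (g := u) (v := v)
    ((hcη.mul hu.continuous).integrable_of_hasCompactSupport (hη2.fderiv_apply ℝ v).mul_right)
    ((hη.continuous.mul hcu).integrable_of_hasCompactSupport hη2.mul_right)
    ((hη.continuous.mul hu.continuous).integrable_of_hasCompactSupport hη2.mul_right)
    (fun x _ => hη.differentiable (by simp) x) (fun x _ => hu.differentiable (by simp) x)
  simp only [hd] at e3
  rw [e1, e2, e3, neg_neg]

/-! ### The trace inequality -/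

theorem eLpNorm_two_sq {X F : Type*} [MeasurableSpace X] [NormedAddCommGroup F] (μ : Measure X)
    (f : X → F) : eLpNorm f 2 μ ^ 2 = ∫⁻ x, ‖f x‖ₑ ^ 2 ∂μ := by
  have := eLpNorm_nnreal_pow_eq_lintegral (μ := μ) (f := f) (p := 2) (by norm_num)
  simpa using this

/-- Cauchy–Schwarz, obtained by expanding the integral of the squared deviation of `h` from its mean
`I / d`. -/
theorem sq_integral_le {d : ℝ} (hd : 0 < d) {h : ℝ → ℝ} (hh : Continuous h) :
    (∫ r in (0 : ℝ)..d, h r) ^ 2 ≤ d * ∫ r in (0 : ℝ)..d, h r ^ 2 := by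
  set I := ∫ r in (0 : ℝ)..d, h r with hI
  have i1 : IntervalIntegrable (fun r => h r ^ 2) volume 0 d := (hh.pow 2).intervalIntegrable _ _
  have i2 : IntervalIntegrable (fun r => 2 * (I / d) * h r) volume 0 d :=
    (continuous_const.mul hh).intervalIntegrable _ _
  have h1 : 0 ≤ ∫ r in (0 : ℝ)..d, (h r - I / d) ^ 2 :=
    intervalIntegral.integral_nonneg hd.le fun _ _ => sq_nonneg _
  have h2 : ∫ r in (0 : ℝ)..d, (h r - I / d) ^ 2 =
      (∫ r in (0 : ℝ)..d, h r ^ 2) - 2 * (I / d) * I + d * (I / d) ^ 2 := by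
    have : ∀ r, (h r - I / d) ^ 2 = (h r ^ 2 - 2 * (I / d) * h r) + (I / d) ^ 2 := fun r => by ring
    simp only [this]
    rw [intervalIntegral.integral_add (i1.sub i2) (by simp),
      intervalIntegral.integral_sub i1 i2, intervalIntegral.integral_const_mul, ← hI]
    simp
  rw [h2] at h1
  have h3 : (∫ r in (0 : ℝ)..d, h r ^ 2) - 2 * (I / d) * I + d * (I / d) ^ 2 =
      (∫ r in (0 : ℝ)..d, h r ^ 2) - I ^ 2 / d := by
    field_simp
    ring
  rw [h3, sub_nonneg, div_le_iff₀ hd] at h1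
  linarith

/-- One-dimensional trace inequality: `f c` differs from `f r` by at most `J = ∫ |f'|`, so `‖f c‖² ≤
2 ‖f r‖² + 2 J²`. Integrating over `r ∈ [0, d]` and using `J² ≤ d ∫ |f'|²` gives the constants. -/
theorem sq_norm_le_integral {d c : ℝ} (hd : 0 < d) (hc : c ∈ Icc 0 d) {f f' : ℝ → ℂ}
    (hf : ∀ r, HasDerivAt f (f' r) r) (hf' : Continuous f') :
    d * ‖f c‖ ^ 2 ≤ 2 * (∫ r in (0 : ℝ)..d, ‖f r‖ ^ 2) +
      2 * d ^ 2 * ∫ r in (0 : ℝ)..d, ‖f' r‖ ^ 2 := by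
  have hcf : Continuous f := continuous_iff_continuousAt.2 fun r => (hf r).continuousAt
  set J := ∫ r in (0 : ℝ)..d, ‖f' r‖
  have hJ : J ^ 2 ≤ d * ∫ r in (0 : ℝ)..d, ‖f' r‖ ^ 2 := sq_integral_le hd hf'.norm
  have h1 (r : ℝ) (hr : r ∈ Icc 0 d) : ‖f c‖ ^ 2 ≤ 2 * ‖f r‖ ^ 2 + 2 * J ^ 2 := by
    have e1 : ∫ t in r..c, f' t = f c - f r :=
      intervalIntegral.integral_eq_sub_of_hasDerivAt (fun t _ => hf t)
        (hf'.intervalIntegrable _ _)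
    have e2 : ‖f c - f r‖ ≤ J := by
      rw [← e1]
      refine intervalIntegral.norm_integral_le_integral_norm_uIoc.trans ?_
      rw [show J = ∫ t in Ioc 0 d, ‖f' t‖ from intervalIntegral.integral_of_le hd.le]
      refine setIntegral_mono_set
        ((hf'.norm.integrableOn_Icc (a := 0) (b := d)).mono_set Ioc_subset_Icc_self)
        (Eventually.of_forall fun _ => norm_nonneg _) (LE.le.eventuallyLE ?_)
      exact Ioc_subset_Ioc (le_min hr.1 hc.1) (max_le hr.2 hc.2)
    have e3 : ‖f c‖ ≤ ‖f r‖ + J := by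
      calc ‖f c‖ = ‖f r + (f c - f r)‖ := by rw [add_sub_cancel]
        _ ≤ _ := (norm_add_le _ _).trans (by gcongr)
    have e4 : 0 ≤ J := (norm_nonneg _).trans e2
    nlinarith [sq_nonneg (‖f r‖ - J), norm_nonneg (f c), norm_nonneg (f r)]
  have i1 : IntervalIntegrable (fun r => 2 * ‖f r‖ ^ 2) volume 0 d :=
    (continuous_const.mul (hcf.norm.pow 2)).intervalIntegrable _ _
  have h2 := intervalIntegral.integral_mono_on (μ := volume)
    (f := fun _ => ‖f c‖ ^ 2) (g := fun r => 2 * ‖f r‖ ^ 2 + 2 * J ^ 2) hd.le (by simp)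
    (i1.add (by simp)) h1
  rw [intervalIntegral.integral_add i1 (by simp), intervalIntegral.integral_const_mul] at h2
  simp only [intervalIntegral.integral_const, sub_zero, smul_eq_mul] at h2
  nlinarith

theorem ofReal_integral_sq_norm {d : ℝ} (hd : 0 < d) {f : ℝ → ℂ} (hf : Continuous f) :
    ENNReal.ofReal (∫ r in (0 : ℝ)..d, ‖f r‖ ^ 2) = ∫⁻ r in Icc 0 d, ‖f r‖ₑ ^ 2 := by
  have hi : IntegrableOn (fun r => ‖f r‖ ^ 2) (Icc 0 d) := (hf.norm.pow 2).integrableOn_Icc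
  rw [intervalIntegral.integral_of_le hd.le, ← integral_Icc_eq_integral_Ioc,
    ofReal_integral_eq_lintegral_ofReal hi
      (Eventually.of_forall fun _ => by positivity)]
  refine lintegral_congr fun r => ?_
  rw [ENNReal.ofReal_pow (norm_nonneg _), ofReal_norm]

theorem sq_enorm_le_lintegral {d c : ℝ} (hd : 0 < d) (hc : c ∈ Icc 0 d) {f f' : ℝ → ℂ}
    (hf : ∀ r, HasDerivAt f (f' r) r) (hf' : Continuous f') :
    ‖f c‖ₑ ^ 2 ≤ ENNReal.ofReal (2 / d) * (∫⁻ r in Icc 0 d, ‖f r‖ₑ ^ 2) +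
      ENNReal.ofReal (2 * d) * ∫⁻ r in Icc 0 d, ‖f' r‖ₑ ^ 2 := by
  have hcf : Continuous f := continuous_iff_continuousAt.2 fun r => (hf r).continuousAt
  rw [← ofReal_integral_sq_norm hd hcf, ← ofReal_integral_sq_norm hd hf',
    ← ENNReal.ofReal_mul (by positivity), ← ENNReal.ofReal_mul (by positivity), ← ofReal_norm,
    ← ENNReal.ofReal_pow (norm_nonneg _)]
  have n1 : 0 ≤ ∫ r in (0 : ℝ)..d, ‖f r‖ ^ 2 :=
    intervalIntegral.integral_nonneg hd.le fun _ _ => by positivity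
  have n2 : 0 ≤ ∫ r in (0 : ℝ)..d, ‖f' r‖ ^ 2 :=
    intervalIntegral.integral_nonneg hd.le fun _ _ => by positivity
  rw [← ENNReal.ofReal_add (by positivity) (by positivity)]
  refine ENNReal.ofReal_le_ofReal ?_
  have h := sq_norm_le_integral hd hc hf hf'
  rw [← mul_le_mul_iff_right₀ hd]
  refine h.trans (le_of_eq ?_)
  field_simp

/-- The horizontal segments from `(s, s)` to `(s + d, s)`, `s ≥ 0`, sweep out the half `x ≥ y` of
the strip; the bound is Tonelli with a translation in each slice. -/
theorem lintegral_lower_le (d : ℝ) {F : ℝ × ℝ → ℝ≥0∞} (hF : Measurable F) :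
    ∫⁻ s in Ici (0 : ℝ), ∫⁻ r in Icc 0 d, F (s + r, s) ≤ ∫⁻ p in strip d, F p := by
  have hm := (isClosed_strip d).measurableSet
  rw [← lintegral_indicator hm, Measure.volume_eq_prod,
    lintegral_prod_symm _ (hF.indicator hm).aemeasurable, ← lintegral_indicator measurableSet_Ici]
  refine lintegral_mono fun s => ?_
  rw [indicator_apply]
  split_ifs with hs
  · rw [← lintegral_add_left_eq_self (μ := volume) _ s, ← lintegral_indicator measurableSet_Icc]
    refine lintegral_mono fun r => ?_
    rw [indicator_apply]
    split_ifs with hr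
    · have hs' : 0 ≤ s := hs
      have : (s + r, s) ∈ strip d :=
        ⟨add_nonneg hs hr.1, hs, by simpa [abs_of_nonneg hr.1] using hr.2⟩
      simp only [indicator_of_mem this, le_refl]
    · exact zero_le
  · exact zero_le

theorem lintegral_upper_le (d : ℝ) {F : ℝ × ℝ → ℝ≥0∞} (hF : Measurable F) :
    ∫⁻ s in Ici (0 : ℝ), ∫⁻ r in Icc 0 d, F (s, s + r) ≤ ∫⁻ p in strip d, F p := by
  have h := lintegral_lower_le d (hF.comp measurable_swap)
  have h2 := (measurePreserving_swap d).lintegral_comp hF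
  simp only [Function.comp_apply, Prod.swap_prod_mk] at h
  exact h.trans h2.le

/-- `γ` is a half-line along which restriction is bounded by the norm of `H¹(Ω)`. -/
def TraceBound (d : ℝ) (γ : ℝ → ℝ × ℝ) : Prop :=
  Continuous γ ∧ ∃ C : ℝ, 0 ≤ C ∧ ∀ u : ℝ × ℝ → ℂ, ContDiff ℝ ∞ u →
    eLpNorm (fun s => u (γ s)) 2 halfLine ≤ ENNReal.ofReal C *
      (eLpNorm u 2 (stripMeasure d) + eLpNorm (fun p => fderiv ℝ u p (1, 0)) 2 (stripMeasure d) +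
        eLpNorm (fun p => fderiv ℝ u p (0, 1)) 2 (stripMeasure d))

/-- Restriction to `s ↦ σ s c` is bounded, for a family of half-lines `σ · r` sweeping out a part of
the strip in the direction `v`. -/
theorem eLpNorm_restrict_le {d c : ℝ} (hd : 0 < d) (hc : c ∈ Icc 0 d) {σ : ℝ → ℝ → ℝ × ℝ}
    {v : ℝ × ℝ} (hσ : ∀ s r, HasDerivAt (σ s) v r) (hσc : Continuous fun p : ℝ × ℝ => σ p.1 p.2)
    (hle : ∀ F : ℝ × ℝ → ℝ≥0∞, Measurable F →
      ∫⁻ s in Ici (0 : ℝ), ∫⁻ r in Icc 0 d, F (σ s r) ≤ ∫⁻ p in strip d, F p)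
    {u : ℝ × ℝ → ℂ} (hu : ContDiff ℝ ∞ u) :
    eLpNorm (fun s => u (σ s c)) 2 halfLine ≤ ENNReal.ofReal √(2 / d + 2 * d) *
      (eLpNorm u 2 (stripMeasure d) +
        eLpNorm (fun p => fderiv ℝ u p v) 2 (stripMeasure d)) := by
  have hcu : Continuous fun p => fderiv ℝ u p v :=
    (hu.continuous_fderiv (by simp)).clm_apply continuous_const
  have m1 : Measurable fun p => ‖u p‖ₑ ^ 2 := hu.continuous.measurable.enorm.pow_const 2
  have m2 : Measurable fun p => ‖fderiv ℝ u p v‖ₑ ^ 2 := hcu.measurable.enorm.pow_const 2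
  have hσs (s : ℝ) : Continuous (σ s) := continuous_iff_continuousAt.2 fun r =>
    (hσ s r).continuousAt
  have hint {F : ℝ × ℝ → ℝ≥0∞} (hF : Measurable F) :
      Measurable fun s => ∫⁻ r in Icc 0 d, F (σ s r) :=
    Measurable.lintegral_prod_right' (f := fun p : ℝ × ℝ => F (σ p.1 p.2))
      (hF.comp hσc.measurable)
  set A := eLpNorm (fun s => u (σ s c)) 2 halfLine with hA
  set B := eLpNorm u 2 (stripMeasure d) with hB
  set G := eLpNorm (fun p => fderiv ℝ u p v) 2 (stripMeasure d) with hG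
  have key : A ^ 2 ≤ ENNReal.ofReal (2 / d) * B ^ 2 + ENNReal.ofReal (2 * d) * G ^ 2 := by
    rw [hA, hB, hG, eLpNorm_two_sq, eLpNorm_two_sq, eLpNorm_two_sq]
    calc ∫⁻ s in Ici (0 : ℝ), ‖u (σ s c)‖ₑ ^ 2
        ≤ ∫⁻ s in Ici (0 : ℝ), (ENNReal.ofReal (2 / d) * (∫⁻ r in Icc 0 d, ‖u (σ s r)‖ₑ ^ 2) +
          ENNReal.ofReal (2 * d) * ∫⁻ r in Icc 0 d, ‖fderiv ℝ u (σ s r) v‖ₑ ^ 2) := by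
          refine lintegral_mono fun s => ?_
          exact sq_enorm_le_lintegral hd hc (f := fun r => u (σ s r))
            (fun r => (hu.differentiable (by simp) _).hasFDerivAt.comp_hasDerivAt r (hσ s r))
            (hcu.comp (hσs s))
      _ = ENNReal.ofReal (2 / d) * (∫⁻ s in Ici (0 : ℝ), ∫⁻ r in Icc 0 d, ‖u (σ s r)‖ₑ ^ 2) +
          ENNReal.ofReal (2 * d) *
            ∫⁻ s in Ici (0 : ℝ), ∫⁻ r in Icc 0 d, ‖fderiv ℝ u (σ s r) v‖ₑ ^ 2 := by
          rw [lintegral_add_left ((hint m1).const_mul _), lintegral_const_mul _ (hint m1),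
            lintegral_const_mul _ (hint m2)]
      _ ≤ _ := by
          gcongr
          · exact hle _ m1
          · exact hle _ m2
  -- The constant is chosen so that its square is the sum of the two coefficients in `key`, each of
  -- which multiplies a term at most `(B + G)²`.
  have hC : ENNReal.ofReal √(2 / d + 2 * d) ^ 2 =
      ENNReal.ofReal (2 / d) + ENNReal.ofReal (2 * d) := by
    rw [← ENNReal.ofReal_pow (Real.sqrt_nonneg _), Real.sq_sqrt (by positivity),
      ENNReal.ofReal_add (by positivity) (by positivity)]
  refine le_of_not_gt fun hlt => ?_
  have h2 := ENNReal.pow_lt_pow_left two_ne_zero hlt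
  refine absurd (h2.trans_le key) (not_lt.2 ?_)
  rw [mul_pow, hC, add_mul]
  gcongr
  · exact le_self_add
  · exact le_add_self

/-- The value `c = 0` is the diagonal and `c = d` the Dirichlet half-line; the same family of
segments serves both. -/
theorem traceBound_of_lower {d c : ℝ} (hd : 0 < d) (hc : c ∈ Icc 0 d) :
    TraceBound d fun s => (s + c, s) := by
  refine ⟨by fun_prop, √(2 / d + 2 * d), Real.sqrt_nonneg _, fun u hu => ?_⟩
  refine (eLpNorm_restrict_le hd hc (σ := fun s r => (s + r, s)) (v := (1, 0))
    (fun s r => ((hasDerivAt_id r).const_add s).prodMk (hasDerivAt_const r s)) (by fun_prop)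
    (fun F hF => lintegral_lower_le d hF) hu).trans ?_
  exact mul_le_mul_right le_self_add _

theorem traceBound_of_upper {d c : ℝ} (hd : 0 < d) (hc : c ∈ Icc 0 d) :
    TraceBound d fun s => (s, s + c) := by
  refine ⟨by fun_prop, √(2 / d + 2 * d), Real.sqrt_nonneg _, fun u hu => ?_⟩
  refine (eLpNorm_restrict_le hd hc (σ := fun s r => (s, s + r)) (v := (0, 1))
    (fun s r => (hasDerivAt_const r s).prodMk ((hasDerivAt_id r).const_add s)) (by fun_prop)
    (fun F hF => lintegral_upper_le d hF) hu).trans ?_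
  gcongr
  exact le_self_add

theorem traceBound_diagonalLine {d : ℝ} (hd : 0 < d) : TraceBound d diagonalLine := by
  have h := traceBound_of_lower hd (left_mem_Icc.2 hd.le)
  simp only [add_zero] at h
  exact h

theorem traceBound_lowerLine {d : ℝ} (hd : 0 < d) : TraceBound d (lowerLine d) :=
  traceBound_of_lower hd (right_mem_Icc.2 hd.le)

theorem traceBound_upperLine {d : ℝ} (hd : 0 < d) : TraceBound d (upperLine d) :=
  traceBound_of_upper hd (right_mem_Icc.2 hd.le)

/-! ### Smoothing up to the boundary -/

/-- A nonnegative test function in the interior of the strip, with integral `1`. -/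
structure StripBump (d : ℝ) where
  toFun : ℝ × ℝ → ℝ
  contDiff : ContDiff ℝ ∞ toFun
  hasCompactSupport : HasCompactSupport toFun
  tsupport_subset : tsupport toFun ⊆ interior (strip d)
  nonneg : ∀ p, 0 ≤ toFun p
  integral_eq_one : ∫ p, toFun p = 1

theorem nonempty_stripBump {d : ℝ} (hd : 0 < d) : Nonempty (StripBump d) := by
  obtain ⟨c, hc⟩ := interior_strip_nonempty hd
  obtain ⟨ε, hε, hb⟩ := Metric.mem_nhds_iff.1 (isOpen_interior.mem_nhds hc)
  let f : ContDiffBump c := ⟨ε / 4, ε / 2, by positivity, by linarith⟩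
  exact ⟨f.normed volume, f.contDiff_normed, f.hasCompactSupport_normed,
    (f.tsupport_normed_eq.subset.trans (Metric.closedBall_subset_ball (half_lt_self hε))).trans hb,
    f.nonneg_normed, f.integral_normed⟩

theorem integral_affine {F : Type*} [NormedAddCommGroup F] [NormedSpace ℝ F] (f : ℝ × ℝ → F)
    (R : ℝ) (b : ℝ × ℝ) :
    ∫ x : ℝ × ℝ, f (b + R • x) = (R ^ 2)⁻¹ • ∫ x, f x := by
  rw [Measure.integral_comp_smul volume (fun x => f (b + x)) R,
    integral_add_left_eq_self (μ := volume) f b, Module.finrank_prod, Module.finrank_self,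
    one_add_one_eq_two, abs_of_nonneg (by positivity)]

theorem lintegral_affine {f : ℝ × ℝ → ℝ≥0∞} (hf : Measurable f) {R : ℝ} (hR : R ≠ 0)
    (b : ℝ × ℝ) :
    ∫⁻ x : ℝ × ℝ, f (b + R • x) = ENNReal.ofReal (R ^ 2)⁻¹ * ∫⁻ x, f x := by
  rw [← lintegral_map (f := fun x => f (b + x)) (g := fun x => R • x)
    (hf.comp (measurable_const_add b)) (measurable_const_smul R),
    Measure.map_addHaar_smul volume hR, lintegral_smul_measure,
    lintegral_add_left_eq_self (μ := volume) f b, Module.finrank_prod, Module.finrank_self,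
    one_add_one_eq_two, abs_of_nonneg (by positivity), smul_eq_mul]

/-- Extension by zero. -/
noncomputable def zeroExt {d : ℝ} (φ : L2 d) : ℝ × ℝ → ℂ := (strip d).indicator φ

theorem zeroExt_eq {d : ℝ} (φ : L2 d) {p : ℝ × ℝ} (hp : p ∈ strip d) : zeroExt φ p = φ p :=
  indicator_of_mem hp _

theorem stronglyMeasurable_zeroExt {d : ℝ} (φ : L2 d) : StronglyMeasurable (zeroExt φ) :=
  (Lp.stronglyMeasurable φ).indicator (isClosed_strip d).measurableSet

theorem memLp_zeroExt {d : ℝ} (φ : L2 d) : MemLp (zeroExt φ) 2 volume :=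
  (memLp_indicator_iff_restrict (isClosed_strip d).measurableSet).2 (Lp.memLp φ)

theorem locallyIntegrable_zeroExt {d : ℝ} (φ : L2 d) : LocallyIntegrable (zeroExt φ) :=
  (memLp_zeroExt φ).locallyIntegrable (by norm_num)

theorem integral_mul_zeroExt {d : ℝ} (f : ℝ × ℝ → ℂ) (φ : L2 d) :
    ∫ p, f p * zeroExt φ p = ∫ p in strip d, f p * φ p := by
  rw [← integral_indicator (isClosed_strip d).measurableSet]
  congr 1 with p
  by_cases hp : p ∈ strip d <;> simp [zeroExt, hp]

/-! ### Averages over points pulled into the interior -/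

namespace StripBump

variable {d : ℝ} (ρ : StripBump d)

/-- The probability measure with density `ρ`. -/
noncomputable def measure : Measure (ℝ × ℝ) :=
  volume.withDensity fun p => ENNReal.ofReal (ρ.toFun p)

theorem measurable_density : Measurable fun p => ENNReal.ofReal (ρ.toFun p) :=
  ρ.contDiff.continuous.measurable.ennreal_ofReal

instance : IsProbabilityMeasure ρ.measure := by
  constructor
  rw [measure, withDensity_apply _ MeasurableSet.univ, Measure.restrict_univ,
    ← ofReal_integral_eq_lintegral_ofReal
      (ρ.contDiff.continuous.integrable_of_hasCompactSupport ρ.hasCompactSupport)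
      (Eventually.of_forall ρ.nonneg), ρ.integral_eq_one, ENNReal.ofReal_one]

theorem ae_mem_tsupport : ∀ᵐ p ∂ρ.measure, p ∈ tsupport ρ.toFun := by
  rw [measure, ae_withDensity_iff ρ.measurable_density]
  refine Eventually.of_forall fun p hp => subset_tsupport _ ?_
  rw [Function.mem_support]
  intro h
  exact hp (by rw [h, ENNReal.ofReal_zero])

theorem integral_measure {F : Type*} [NormedAddCommGroup F] [NormedSpace ℝ F] (f : ℝ × ℝ → F) :
    ∫ p, f p ∂ρ.measure = ∫ p, ρ.toFun p • f p := by
  rw [measure, integral_withDensity_eq_integral_toReal_smul ρ.measurable_density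
    (Eventually.of_forall fun _ => ENNReal.ofReal_lt_top)]
  simp only [ENNReal.toReal_ofReal (ρ.nonneg _)]

/-- The average of `φ` over the points `(1 - t) p + t w`, with `w` distributed according to `ρ`. By
convexity, these points lie in the interior of the strip if `p` lies in the strip and `0 < t`. -/
noncomputable def smoothing (t : ℝ) (φ : L2 d) (p : ℝ × ℝ) : ℂ :=
  ∫ w, zeroExt φ ((1 - t) • p + t • w) ∂ρ.measure

/-- The rescaled and reflected density, as a complex function. -/
noncomputable def kernel (t : ℝ) (x : ℝ × ℝ) : ℂ := (ρ.toFun (-t⁻¹ • x) : ℂ)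

theorem contDiff_kernel (t : ℝ) : ContDiff ℝ ∞ (ρ.kernel t) :=
  Complex.ofRealCLM.contDiff.comp (ρ.contDiff.comp (contDiff_const_smul _))

theorem hasCompactSupport_kernel {t : ℝ} (ht : t ≠ 0) : HasCompactSupport (ρ.kernel t) :=
  hasCompactSupport_ofReal (ρ.hasCompactSupport.comp_smul (neg_ne_zero.2 (inv_ne_zero ht)))

/-- Substitute `s = (1 - t) p + t w`, with Jacobian `t²`. Then `w = -t⁻¹ ((1 - t) p - s)`, which
explains the reflection in `kernel`. -/
theorem smoothing_eq_convolution {t : ℝ} (ht : t ≠ 0) (φ : L2 d) (p : ℝ × ℝ) :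
    ρ.smoothing t φ p = (t ^ 2)⁻¹ •
      convolution (zeroExt φ) (ρ.kernel t) (ContinuousLinearMap.mul ℝ ℂ) volume ((1 - t) • p) := by
  rw [smoothing, integral_measure, convolution,
    ← integral_affine _ t ((1 - t) • p)]
  congr 1 with w
  have : -t⁻¹ • ((1 - t) • p - ((1 - t) • p + t • w)) = w := by
    rw [sub_add_cancel_left, smul_neg, neg_smul, neg_neg, smul_smul, inv_mul_cancel₀ ht, one_smul]
  rw [ContinuousLinearMap.mul_apply', kernel, this, mul_comm, Complex.real_smul]

theorem contDiff_smoothing {t : ℝ} (ht : t ≠ 0) (φ : L2 d) : ContDiff ℝ ∞ (ρ.smoothing t φ) := by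
  have h := (ρ.hasCompactSupport_kernel ht).contDiff_convolution_right (n := ⊤)
    (ContinuousLinearMap.mul ℝ ℂ) (locallyIntegrable_zeroExt φ) (ρ.contDiff_kernel t)
  have h2 := (h.comp (contDiff_const_smul (1 - t))).const_smul (t ^ 2)⁻¹
  exact (funext fun p => ρ.smoothing_eq_convolution ht φ p : ρ.smoothing t φ = _) ▸ h2

/-- The factor `1 - t` is the chain rule for `p ↦ (1 - t) p`. The derivative falls on the kernel and
is moved onto `φ` by the definition of the weak derivative, for boundary points `p` as well. -/
theorem fderiv_smoothing {t : ℝ} (ht : t ∈ Ioo (0 : ℝ) 1) {v : ℝ × ℝ} {φ g : L2 d}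
    (hg : HasWeakDeriv d v φ g) {p : ℝ × ℝ} (hp : p ∈ strip d) :
    fderiv ℝ (ρ.smoothing t φ) p v = ((1 - t : ℝ) : ℂ) * ρ.smoothing t g p := by
  have ht0 := ht.1.ne'
  set x := (1 - t) • p with hx
  have hK := (ρ.contDiff_kernel t)
  have hKs := ρ.hasCompactSupport_kernel ht0
  have hconv := hKs.hasFDerivAt_convolution_right (ContinuousLinearMap.mul ℝ ℂ)
    (locallyIntegrable_zeroExt φ) (hK.of_le (by simp)) x
  have hlin : HasFDerivAt (fun p : ℝ × ℝ => (1 - t) • p)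
      ((1 - t) • ContinuousLinearMap.id ℝ (ℝ × ℝ)) p := (hasFDerivAt_id p).const_smul (1 - t)
  have h1 := (hconv.comp p hlin).const_smul (t ^ 2)⁻¹
  have h2 : ρ.smoothing t φ = (t ^ 2)⁻¹ • (convolution (zeroExt φ) (ρ.kernel t)
      (ContinuousLinearMap.mul ℝ ℂ) volume ∘ fun p : ℝ × ℝ => (1 - t) • p) :=
    funext fun p => ρ.smoothing_eq_convolution ht0 φ p
  rw [h2, HasFDerivAt.fderiv h1, ρ.smoothing_eq_convolution ht0]
  simp only [smul_apply, ContinuousLinearMap.comp_apply,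
    ContinuousLinearMap.id_apply, map_smul]
  rw [convolution_precompR_apply _ (locallyIntegrable_zeroExt φ) (hKs.fderiv ℝ)
    (hK.continuous_fderiv (by simp))]
  -- The kernel centred at `x` is an admissible test function: its support lies in `(1 - t) p + t
  -- supp ρ`, which convexity places in the interior of the strip. Hence the jump of the zero
  -- extension is never seen.
  let η : ℝ × ℝ → ℝ := fun s => ρ.toFun (-t⁻¹ • (x - s))
  have hη : ContDiff ℝ ∞ η :=
    ρ.contDiff.comp (by fun_prop : ContDiff ℝ ∞ fun s : ℝ × ℝ => -t⁻¹ • (x - s))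
  have hpre : tsupport η ⊆ (fun s : ℝ × ℝ => -t⁻¹ • (x - s)) ⁻¹' tsupport ρ.toFun :=
    closure_minimal (fun s hs => subset_tsupport _ hs)
      ((isClosed_tsupport _).preimage (by fun_prop))
  have hinv (s : ℝ × ℝ) : s = (1 - t) • p + t • (-t⁻¹ • (x - s)) := by
    rw [neg_smul, smul_neg, smul_smul, mul_inv_cancel₀ ht0, one_smul, hx]
    abel
  have hηc : HasCompactSupport η := by
    refine HasCompactSupport.of_support_subset_isCompact
      (ρ.hasCompactSupport.isCompact.image (f := fun w => (1 - t) • p + t • w) (by fun_prop))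
      fun s hs => ⟨-t⁻¹ • (x - s), hpre (subset_tsupport _ hs), (hinv s).symm⟩
  have hηs : tsupport η ⊆ interior (strip d) := fun s hs => by
    rw [hinv s]
    exact (convex_strip d).combo_self_interior_mem_interior hp
      (ρ.tsupport_subset (hpre hs)) (by linarith [ht.2]) ht.1 (by ring)
  have hηd (s : ℝ × ℝ) : fderiv ℝ (ρ.kernel t) (x - s) v = -(fderiv ℝ η s v : ℂ) := by
    have e1 : HasFDerivAt (fun s => ((η s : ℝ) : ℂ))
        (Complex.ofRealCLM.comp (fderiv ℝ η s)) s :=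
      Complex.ofRealCLM.hasFDerivAt.comp s (hη.differentiable (by simp) s).hasFDerivAt
    have e2 := (hK.differentiable (by simp) (x - s)).hasFDerivAt.comp s
      ((hasFDerivAt_id s).const_sub x)
    have e3 := DFunLike.congr_fun (e1.unique e2) v
    simp only [ContinuousLinearMap.comp_apply, neg_apply,
      ContinuousLinearMap.id_apply, map_neg] at e3
    rw [← neg_eq_iff_eq_neg, ← e3]
    rfl
  have c1 : convolution (zeroExt φ) (fun a => fderiv ℝ (ρ.kernel t) a v)
      (ContinuousLinearMap.mul ℝ ℂ) volume x = -∫ s in strip d, (fderiv ℝ η s v : ℂ) * φ s := by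
    rw [← integral_mul_zeroExt, ← integral_neg, convolution]
    refine integral_congr_ae (Eventually.of_forall fun s => ?_)
    simp only [ContinuousLinearMap.mul_apply', hηd]
    ring
  have c2 : convolution (zeroExt g) (ρ.kernel t) (ContinuousLinearMap.mul ℝ ℂ) volume x =
      ∫ s in strip d, (η s : ℂ) * g s := by
    rw [← integral_mul_zeroExt, convolution]
    refine integral_congr_ae (Eventually.of_forall fun s => ?_)
    simp only [ContinuousLinearMap.mul_apply']
    rw [mul_comm]
    rfl
  rw [c1, c2, hg η hη hηc hηs, neg_neg]
  simp only [Complex.real_smul]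
  ring

end StripBump

theorem tendsto_eLpNorm_two_of_lintegral {X F ι : Type*} [MeasurableSpace X]
    [NormedAddCommGroup F] {μ : Measure X} {l : Filter ι} {f : ι → X → F}
    (h : Tendsto (fun n => ∫⁻ x, ‖f n x‖ₑ ^ 2 ∂μ) l (𝓝 0)) :
    Tendsto (fun n => eLpNorm (f n) 2 μ) l (𝓝 0) := by
  have h1 := (ENNReal.continuous_rpow_const (y := 1 / 2)).tendsto 0 |>.comp h
  rw [ENNReal.zero_rpow_of_pos (by norm_num)] at h1
  refine h1.congr fun n => ?_
  rw [Function.comp_apply, ← eLpNorm_two_sq, ← ENNReal.rpow_natCast, ← ENNReal.rpow_mul]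
  norm_num

/-! ### `L²` convergence of the averages -/

namespace StripBump

variable {d : ℝ} (ρ : StripBump d)

/-- The density `ρ` is bounded, so its measure is dominated by a multiple of Lebesgue measure. -/
theorem memLp_affine {F : Type*} [NormedAddCommGroup F] {f : ℝ × ℝ → F}
    (hf : StronglyMeasurable f) (hf2 : MemLp f 2 volume) {t : ℝ} (ht : t ≠ 0) (a : ℝ × ℝ) :
    MemLp (fun w => f (a + t • w)) 2 ρ.measure := by
  obtain ⟨C, hC⟩ := ρ.contDiff.continuous.bounded_above_of_compact_support ρ.hasCompactSupport
  have hle : ρ.measure ≤ ENNReal.ofReal C • volume := by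
    rw [← withDensity_const]
    refine withDensity_mono (Eventually.of_forall fun p => ENNReal.ofReal_le_ofReal ?_)
    exact (le_abs_self _).trans (hC p)
  refine MemLp.of_measure_le_smul ENNReal.ofReal_ne_top hle
    ⟨(hf.comp_measurable (by fun_prop)).aestronglyMeasurable, ?_⟩
  have h : eLpNorm (fun w => f (a + t • w)) 2 volume ^ 2 < ⊤ := by
    rw [eLpNorm_two_sq, lintegral_affine (f := fun x => ‖f x‖ₑ ^ 2) (hf.enorm.pow_const 2) ht a,
      ← eLpNorm_two_sq]
    exact ENNReal.mul_lt_top ENNReal.ofReal_lt_top (ENNReal.pow_lt_top hf2.2)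
  by_contra hn
  rw [not_lt_top_iff] at hn
  simp [hn] at h

/-- Jensen's inequality for the probability measure `ρ.measure`, in the form `L¹ ≤ L²`. -/
theorem sq_enorm_smoothing_sub_le {t : ℝ} (ht : t ≠ 0) (φ : L2 d) (p : ℝ × ℝ) :
    ‖ρ.smoothing t φ p - zeroExt φ p‖ₑ ^ 2 ≤
      ∫⁻ w, ‖zeroExt φ ((1 - t) • p + t • w) - zeroExt φ p‖ₑ ^ 2 ∂ρ.measure := by
  have h1 : MemLp (fun w => zeroExt φ ((1 - t) • p + t • w)) 2 ρ.measure :=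
    ρ.memLp_affine (stronglyMeasurable_zeroExt φ) (memLp_zeroExt φ) ht _
  have h2 : ρ.smoothing t φ p - zeroExt φ p =
      ∫ w, (zeroExt φ ((1 - t) • p + t • w) - zeroExt φ p) ∂ρ.measure := by
    rw [integral_sub (h1.integrable (by norm_num)) (integrable_const _), integral_const]
    simp [smoothing]
  rw [h2, ← eLpNorm_two_sq]
  refine pow_le_pow_left₀ zero_le ((enorm_integral_le_lintegral_enorm _).trans ?_) 2
  rw [← eLpNorm_one_eq_lintegral_enorm]
  exact eLpNorm_le_eLpNorm_of_exponent_le (by norm_num)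
    (h1.aestronglyMeasurable.sub aestronglyMeasurable_const)

/-- The joint distribution of a point of the strip and a random point `w`. -/
noncomputable abbrev joint : Measure ((ℝ × ℝ) × ℝ × ℝ) := (stripMeasure d).prod ρ.measure

theorem eLpNorm_smoothing_sub_le {t : ℝ} (ht : t ≠ 0) (φ : L2 d) :
    eLpNorm (fun p => ρ.smoothing t φ p - φ p) 2 (stripMeasure d) ≤
      eLpNorm (fun q : (ℝ × ℝ) × ℝ × ℝ =>
        zeroExt φ ((1 - t) • q.1 + t • q.2) - zeroExt φ q.1) 2 ρ.joint := by
  have hm : Measurable fun q : (ℝ × ℝ) × ℝ × ℝ =>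
      ‖zeroExt φ ((1 - t) • q.1 + t • q.2) - zeroExt φ q.1‖ₑ ^ 2 := by
    have := (stronglyMeasurable_zeroExt φ).measurable
    fun_prop
  rw [← ENNReal.pow_le_pow_left_iff two_ne_zero, eLpNorm_two_sq, eLpNorm_two_sq,
    lintegral_prod _ hm.aemeasurable]
  refine lintegral_mono_ae ?_
  filter_upwards [ae_restrict_mem (isClosed_strip d).measurableSet] with p hp
  rw [← zeroExt_eq φ hp]
  exact ρ.sq_enorm_smoothing_sub_le ht φ p

/-- For fixed `w` the map `p ↦ (1 - t) p + t w` has Jacobian `(1 - t)²`, and `w` carries total mass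
`1`. The bound is uniform for `t ≤ 1/2`. -/
theorem eLpNorm_joint_affine_le {t : ℝ} (ht : t < 1) {G : ℝ × ℝ → ℂ} (hG : Measurable G) :
    eLpNorm (fun q : (ℝ × ℝ) × ℝ × ℝ => G ((1 - t) • q.1 + t • q.2)) 2 ρ.joint ≤
      ENNReal.ofReal (1 - t)⁻¹ * eLpNorm G 2 volume := by
  have h1t : 0 < 1 - t := by linarith
  have hm : Measurable fun q : (ℝ × ℝ) × ℝ × ℝ => ‖G ((1 - t) • q.1 + t • q.2)‖ₑ ^ 2 := by
    fun_prop
  rw [← ENNReal.pow_le_pow_left_iff two_ne_zero, mul_pow, eLpNorm_two_sq, eLpNorm_two_sq,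
    lintegral_prod_symm _ hm.aemeasurable, ← ENNReal.ofReal_pow (by positivity), inv_pow]
  calc ∫⁻ w, (∫⁻ p in strip d, ‖G ((1 - t) • p + t • w)‖ₑ ^ 2) ∂ρ.measure
      ≤ ∫⁻ _, ENNReal.ofReal ((1 - t) ^ 2)⁻¹ * (∫⁻ p, ‖G p‖ₑ ^ 2) ∂ρ.measure := by
        refine lintegral_mono fun w => (setLIntegral_le_lintegral _ _).trans ?_
        rw [← lintegral_affine (f := fun x => ‖G x‖ₑ ^ 2) (hG.enorm.pow_const 2) h1t.ne' (t • w)]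
        simp only [add_comm, le_refl]
    _ = _ := by simp

theorem tendsto_eLpNorm_joint_sub {t : ℕ → ℝ} (ht : Tendsto t atTop (𝓝 0))
    (ht1 : ∀ n, t n ∈ Ioc (0 : ℝ) 2⁻¹) {g : ℝ × ℝ → ℂ} (hg : Continuous g)
    (hgc : HasCompactSupport g) :
    Tendsto (fun n => eLpNorm (fun q : (ℝ × ℝ) × ℝ × ℝ =>
      g ((1 - t n) • q.1 + t n • q.2) - g q.1) 2 ρ.joint) atTop (𝓝 0) := by
  refine tendsto_eLpNorm_two_of_lintegral ?_
  obtain ⟨M, hM⟩ := hg.bounded_above_of_compact_support hgc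
  have hM0 : 0 ≤ M := (norm_nonneg _).trans (hM 0)
  obtain ⟨R, hR⟩ := hgc.isCompact.isBounded.subset_closedBall 0
  obtain ⟨S, hS⟩ := ρ.hasCompactSupport.isCompact.isBounded.subset_closedBall 0
  -- For `t ≤ 1/2` and `‖w‖ ≤ |S|`, `‖(1 - t) p + t w‖ ≥ ‖p‖ / 2 - |S|`, which exceeds `R` once `‖p‖
  -- > 2 (R + |S|)`. Outside this ball both values of `g` vanish, so the dominating function is
  -- integrable.
  let B : Set ((ℝ × ℝ) × ℝ × ℝ) := Metric.closedBall 0 (max R (2 * (R + |S|))) ×ˢ univ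
  have hB : MeasurableSet B := Metric.isClosed_closedBall.measurableSet.prod MeasurableSet.univ
  have hzero {p : ℝ × ℝ} (hp : R < ‖p‖) : g p = 0 :=
    image_eq_zero_of_notMem_tsupport fun h => by
      have := hR h
      rw [mem_closedBall_zero_iff] at this
      linarith
  have hgm := hg.measurable
  have key := tendsto_lintegral_of_dominated_convergence (μ := ρ.joint)
    (F := fun n q => ‖g ((1 - t n) • q.1 + t n • q.2) - g q.1‖ₑ ^ 2) (f := fun _ => 0)
    (B.indicator fun _ => ENNReal.ofReal (2 * M) ^ 2) (fun n => by fun_prop) (fun n => ?_) ?_ ?_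
  · simpa using key
  · have hw : ∀ᵐ q ∂ρ.joint, q.2 ∈ tsupport ρ.toFun :=
      Measure.quasiMeasurePreserving_snd.ae ρ.ae_mem_tsupport
    filter_upwards [hw] with q hq
    by_cases hqB : q ∈ B
    · rw [indicator_of_mem hqB, ← ofReal_norm]
      gcongr
      refine (norm_sub_le _ _).trans ?_
      linarith [hM ((1 - t n) • q.1 + t n • q.2), hM q.1]
    · rw [indicator_of_notMem hqB]
      have h1 : max R (2 * (R + |S|)) < ‖q.1‖ := by
        by_contra hn
        exact hqB ⟨mem_closedBall_zero_iff.2 (not_lt.1 hn), mem_univ _⟩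
      have h2 := (le_max_left _ _).trans_lt h1
      have h3 := (le_max_right _ _).trans_lt h1
      have h4 : ‖q.2‖ ≤ |S| := (mem_closedBall_zero_iff.1 (hS hq)).trans (le_abs_self S)
      have h5 : R < ‖(1 - t n) • q.1 + t n • q.2‖ := by
        have e1 : ‖(1 - t n) • q.1‖ - ‖t n • q.2‖ ≤ ‖(1 - t n) • q.1 + t n • q.2‖ := by
          have := norm_sub_norm_le ((1 - t n) • q.1) (-(t n • q.2))
          rwa [norm_neg, sub_neg_eq_add] at this
        rw [norm_smul, norm_smul, Real.norm_of_nonneg (ht1 n).1.le,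
          Real.norm_of_nonneg (by linarith [(ht1 n).2])] at e1
        have e2 : 2⁻¹ * ‖q.1‖ ≤ (1 - t n) * ‖q.1‖ := by
          gcongr
          linarith [(ht1 n).2]
        have e3 : t n * ‖q.2‖ ≤ 1 * |S| :=
          mul_le_mul (by linarith [(ht1 n).2]) h4 (norm_nonneg _) zero_le_one
        linarith
      simp [hzero h5, hzero h2]
  · rw [lintegral_indicator_const hB]
    refine ENNReal.mul_ne_top (ENNReal.pow_ne_top ENNReal.ofReal_ne_top) ?_
    rw [Measure.prod_prod, measure_univ, mul_one]
    exact (isCompact_closedBall _ _).measure_lt_top.ne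
  · refine Eventually.of_forall fun q => ?_
    have h1 : Tendsto (fun n => (1 - t n) • q.1 + t n • q.2) atTop (𝓝 q.1) := by
      have := ((tendsto_const_nhds (x := (1 : ℝ)).sub ht).smul_const q.1).add (ht.smul_const q.2)
      simpa using this
    have h2 := ENNReal.Tendsto.pow (n := 2) ((((hg.tendsto q.1).comp h1).sub_const (g q.1)).enorm)
    simpa using h2

theorem tendsto_smoothing {t : ℕ → ℝ} (ht : Tendsto t atTop (𝓝 0))
    (ht1 : ∀ n, t n ∈ Ioc (0 : ℝ) 2⁻¹) (φ : L2 d) :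
    Tendsto (fun n => eLpNorm (fun p => ρ.smoothing (t n) φ p - φ p) 2 (stripMeasure d))
      atTop (𝓝 0) := by
  have hmS := (isClosed_strip d).measurableSet
  rw [ENNReal.tendsto_nhds_zero]
  intro ε hε
  -- The error splits into `G` at the moved point (at most `2δ`), the increment of `g` (eventually
  -- at most `δ`) and `G` at the original point (at most `δ`).
  obtain ⟨δ, hδ, hδε⟩ : ∃ δ : ℝ, 0 < δ ∧ 4 * ENNReal.ofReal δ ≤ ε := by
    rcases eq_or_ne ε ⊤ with rfl | hεt
    · exact ⟨1, one_pos, le_top⟩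
    · refine ⟨ε.toReal / 4, by have := ENNReal.toReal_pos hε.ne' hεt; positivity, ?_⟩
      rw [show (4 : ℝ≥0∞) = ENNReal.ofReal 4 by simp, ← ENNReal.ofReal_mul (by norm_num),
        mul_div_cancel₀ _ (by norm_num), ENNReal.ofReal_toReal hεt]
  obtain ⟨g, hgc, hg, hgφ⟩ := (Lp.memLp φ).exist_eLpNorm_sub_le (by norm_num) (by norm_num) hδ
  -- The approximation by `g` holds only on the strip, so the remainder is cut off there. Convexity
  -- keeps the moved point in the strip, where `φ = G + g` remains valid.
  set G : ℝ × ℝ → ℂ := (strip d).indicator (φ - g) with hG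
  have hgm := hg.continuous.measurable
  have hφm := (stronglyMeasurable_zeroExt φ).measurable
  have hGm : Measurable G := ((Lp.stronglyMeasurable φ).measurable.sub hgm).indicator hmS
  have hGn : eLpNorm G 2 volume ≤ ENNReal.ofReal δ := by
    rwa [hG, eLpNorm_indicator_eq_eLpNorm_restrict hmS]
  have hGn' : eLpNorm G 2 (stripMeasure d) ≤ ENNReal.ofReal δ :=
    (eLpNorm_mono_measure _ Measure.restrict_le_self).trans hGn
  have hGp {p : ℝ × ℝ} (hp : p ∈ strip d) : zeroExt φ p = G p + g p := by
    rw [zeroExt_eq φ hp, hG, indicator_of_mem hp, Pi.sub_apply, sub_add_cancel]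
  filter_upwards [(ENNReal.tendsto_nhds_zero.1 (ρ.tendsto_eLpNorm_joint_sub ht ht1 hg.continuous
    hgc)) (ENNReal.ofReal δ) (by simpa)] with n hn
  refine (ρ.eLpNorm_smoothing_sub_le (ht1 n).1.ne' φ).trans ?_
  have hae : (fun q : (ℝ × ℝ) × ℝ × ℝ =>
      zeroExt φ ((1 - t n) • q.1 + t n • q.2) - zeroExt φ q.1) =ᵐ[ρ.joint]
      (fun q => G ((1 - t n) • q.1 + t n • q.2)) +
        ((fun q => g ((1 - t n) • q.1 + t n • q.2) - g q.1) - fun q => G q.1) := by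
    have hw : ∀ᵐ q ∂ρ.joint, q.2 ∈ tsupport ρ.toFun :=
      Measure.quasiMeasurePreserving_snd.ae ρ.ae_mem_tsupport
    have hp : ∀ᵐ q ∂ρ.joint, q.1 ∈ strip d :=
      Measure.quasiMeasurePreserving_fst.ae (ae_restrict_mem hmS)
    filter_upwards [hw, hp] with q hq1 hq2
    have hA : (1 - t n) • q.1 + t n • q.2 ∈ strip d :=
      convex_strip d hq2 (interior_subset (ρ.tsupport_subset hq1))
        (by linarith [(ht1 n).2]) (ht1 n).1.le (by ring)
    simp only [Pi.add_apply, Pi.sub_apply, hGp hA, hGp hq2]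
    ring
  have m1 : AEStronglyMeasurable
      (fun q : (ℝ × ℝ) × ℝ × ℝ => G ((1 - t n) • q.1 + t n • q.2)) ρ.joint :=
    (by fun_prop : Measurable _).aestronglyMeasurable
  have m2 : AEStronglyMeasurable
      (fun q : (ℝ × ℝ) × ℝ × ℝ => g ((1 - t n) • q.1 + t n • q.2) - g q.1) ρ.joint :=
    (by fun_prop : Measurable _).aestronglyMeasurable
  have m3 : AEStronglyMeasurable (fun q : (ℝ × ℝ) × ℝ × ℝ => G q.1) ρ.joint :=
    (by fun_prop : Measurable _).aestronglyMeasurable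
  have b1 : eLpNorm (fun q : (ℝ × ℝ) × ℝ × ℝ => G ((1 - t n) • q.1 + t n • q.2)) 2 ρ.joint ≤
      2 * ENNReal.ofReal δ := by
    refine (ρ.eLpNorm_joint_affine_le (by linarith [(ht1 n).2]) hGm).trans ?_
    gcongr
    rw [show (2 : ℝ≥0∞) = ENNReal.ofReal 2 by simp]
    refine ENNReal.ofReal_le_ofReal (inv_le_of_inv_le₀ (by norm_num) ?_)
    linarith [(ht1 n).2]
  have b3 : eLpNorm (fun q : (ℝ × ℝ) × ℝ × ℝ => G q.1) 2 ρ.joint ≤ ENNReal.ofReal δ :=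
    (eLpNorm_comp_measurePreserving hGm.aestronglyMeasurable
      (measurePreserving_fst (μ := stripMeasure d) (ν := ρ.measure))).trans_le hGn'
  rw [eLpNorm_congr_ae hae]
  calc _ ≤ _ + (_ + _) := (eLpNorm_add_le m1 (m2.sub m3) (by norm_num)).trans
        (by gcongr; exact eLpNorm_sub_le m2 m3 (by norm_num))
    _ ≤ 2 * ENNReal.ofReal δ + (ENNReal.ofReal δ + ENNReal.ofReal δ) := by gcongr
    _ = 4 * ENNReal.ofReal δ := by ring
    _ ≤ ε := hδε

end StripBump

/-! ### Existence, uniqueness and boundedness of traces -/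

theorem continuous_fderiv_apply {u : ℝ × ℝ → ℂ} (hu : ContDiff ℝ ∞ u) (v : ℝ × ℝ) :
    Continuous fun p => fderiv ℝ u p v :=
  (hu.continuous_fderiv (by simp)).clm_apply continuous_const

/-- With `S` the averaging operator and `f = ∂ᵥφ`, `∂ᵥ(S φ) - f = (1 - t) (S f - f) - t f` on the
strip, and both terms tend to `0` in `L²`. -/
theorem exists_smooth_approx {d : ℝ} (hd : 0 < d) {φ g h : L2 d}
    (hg : HasWeakDeriv d (1, 0) φ g) (hh : HasWeakDeriv d (0, 1) φ h) :
    ∃ u : ℕ → ℝ × ℝ → ℂ, (∀ n, ContDiff ℝ ∞ (u n)) ∧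
      Tendsto (fun n => eLpNorm (fun p => u n p - φ p) 2 (stripMeasure d)) atTop (𝓝 0) ∧
      Tendsto (fun n => eLpNorm (fun p => fderiv ℝ (u n) p (1, 0) - g p) 2 (stripMeasure d))
        atTop (𝓝 0) ∧
      Tendsto (fun n => eLpNorm (fun p => fderiv ℝ (u n) p (0, 1) - h p) 2 (stripMeasure d))
        atTop (𝓝 0) := by
  obtain ⟨ρ⟩ := nonempty_stripBump hd
  let t : ℕ → ℝ := fun n => 1 / ((n : ℝ) + 1) / 2
  have ht : Tendsto t atTop (𝓝 0) := by
    have := (tendsto_one_div_add_atTop_nhds_zero_nat (𝕜 := ℝ)).div_const 2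
    rwa [zero_div] at this
  have ht1 (n : ℕ) : t n ∈ Ioc (0 : ℝ) 2⁻¹ := by
    refine ⟨by positivity, ?_⟩
    have : 1 / ((n : ℝ) + 1) ≤ 1 := by
      rw [div_le_one (by positivity)]
      linarith [Nat.cast_nonneg (α := ℝ) n]
    change 1 / ((n : ℝ) + 1) / 2 ≤ 2⁻¹
    linarith
  have key {v : ℝ × ℝ} {f : L2 d} (hf : HasWeakDeriv d v φ f) :
      Tendsto (fun n => eLpNorm (fun p => fderiv ℝ (ρ.smoothing (t n) φ) p v - f p) 2
        (stripMeasure d)) atTop (𝓝 0) := by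
    have h1 := ρ.tendsto_smoothing ht ht1 f
    have h2 : Tendsto (fun n => ‖((t n : ℝ) : ℂ)‖ₑ * eLpNorm f 2 (stripMeasure d)) atTop
        (𝓝 0) := by
      have e1 : Tendsto (fun n => ‖((t n : ℝ) : ℂ)‖ₑ) atTop (𝓝 0) := by
        simpa using ((Complex.continuous_ofReal.tendsto 0).comp ht).enorm
      simpa using ENNReal.Tendsto.mul_const e1 (Or.inr (Lp.eLpNorm_ne_top f))
    have h3 := h1.add h2
    rw [add_zero] at h3
    refine tendsto_of_tendsto_of_tendsto_of_le_of_le tendsto_const_nhds h3 (fun _ => zero_le)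
      fun n => ?_
    have hS := (ρ.contDiff_smoothing (ht1 n).1.ne' f).continuous
    have hae : (fun p => fderiv ℝ (ρ.smoothing (t n) φ) p v - f p) =ᵐ[stripMeasure d]
        (((1 - t n : ℝ) : ℂ) • fun p => ρ.smoothing (t n) f p - f p) -
          ((t n : ℝ) : ℂ) • (f : ℝ × ℝ → ℂ) := by
      filter_upwards [ae_restrict_mem (isClosed_strip d).measurableSet] with p hp
      rw [ρ.fderiv_smoothing ⟨(ht1 n).1, by linarith [(ht1 n).2]⟩ hf hp]
      simp only [Pi.sub_apply, Pi.smul_apply, smul_eq_mul]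
      push_cast
      ring
    have hm := hS.aestronglyMeasurable.sub (Lp.aestronglyMeasurable f)
    rw [eLpNorm_congr_ae hae]
    refine (eLpNorm_sub_le (hm.const_smul _) ((Lp.aestronglyMeasurable f).const_smul _)
      (by norm_num)).trans ?_
    rw [eLpNorm_const_smul, eLpNorm_const_smul]
    gcongr
    refine mul_le_of_le_one_left zero_le ?_
    rw [← ofReal_norm, Complex.norm_real, Real.norm_of_nonneg (by linarith [(ht1 n).2])]
    exact ENNReal.ofReal_le_one.2 (by linarith [(ht1 n).1])
  exact ⟨fun n => ρ.smoothing (t n) φ, fun n => ρ.contDiff_smoothing (ht1 n).1.ne' φ,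
    ρ.tendsto_smoothing ht ht1 φ, key hg, key hh⟩

/-- Convergence to an element of `L²` in norm is convergence in `L²`, for large indices. -/
theorem exists_forall_ge_memLp {X : Type*} [MeasurableSpace X] {μ : Measure X} {f : ℕ → X → ℂ}
    (hf : ∀ n, AEStronglyMeasurable (f n) μ) {φ : Lp ℂ 2 μ}
    (h : Tendsto (fun n => eLpNorm (fun p => f n p - φ p) 2 μ) atTop (𝓝 0)) :
    ∃ N, ∀ n ≥ N, MemLp (f n) 2 μ := by
  have h1 := h.eventually (gt_mem_nhds (show (0 : ℝ≥0∞) < 1 by norm_num))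
  obtain ⟨N, hN⟩ := eventually_atTop.1 h1
  refine ⟨N, fun n hn => ?_⟩
  have h2 : MemLp (fun p => f n p - φ p) 2 μ :=
    ⟨(hf n).sub (Lp.aestronglyMeasurable φ), (hN n hn).trans (by norm_num)⟩
  have h3 := h2.add (Lp.memLp φ)
  refine h3.ae_eq (Eventually.of_forall fun p => ?_)
  simp

theorem tendsto_toLp {X : Type*} [MeasurableSpace X] {μ : Measure X} {f : ℕ → X → ℂ}
    (hf : ∀ n, MemLp (f n) 2 μ) {φ : Lp ℂ 2 μ} :
    Tendsto (fun n => (hf n).toLp) atTop (𝓝 φ) ↔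
      Tendsto (fun n => eLpNorm (fun p => f n p - φ p) 2 μ) atTop (𝓝 0) := by
  rw [Lp.tendsto_Lp_iff_tendsto_eLpNorm']
  refine tendsto_congr fun n => eLpNorm_congr_ae ?_
  filter_upwards [(hf n).coeFn_toLp] with p hp
  rw [Pi.sub_apply, hp]

/-- The data of `HasTrace`, in terms of elements of `L²`. -/
theorem HasTrace.exists_Lp {d : ℝ} {γ : ℝ → ℝ × ℝ} (hγ : Continuous γ) {φ : L2 d}
    {τ : Lp ℂ 2 halfLine} (h : HasTrace d γ φ τ) :
    ∃ g h : L2 d, HasWeakDeriv d (1, 0) φ g ∧ HasWeakDeriv d (0, 1) φ h ∧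
      ∃ (u : ℕ → ℝ × ℝ → ℂ) (U G H : ℕ → L2 d) (T : ℕ → Lp ℂ 2 halfLine),
        (∀ n, ContDiff ℝ ∞ (u n)) ∧ (∀ n, U n =ᵐ[stripMeasure d] u n) ∧
        (∀ n, G n =ᵐ[stripMeasure d] fun p => fderiv ℝ (u n) p (1, 0)) ∧
        (∀ n, H n =ᵐ[stripMeasure d] fun p => fderiv ℝ (u n) p (0, 1)) ∧
        (∀ n, T n =ᵐ[halfLine] fun s => u n (γ s)) ∧
        Tendsto U atTop (𝓝 φ) ∧ Tendsto G atTop (𝓝 g) ∧ Tendsto H atTop (𝓝 h) ∧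
        Tendsto T atTop (𝓝 τ) := by
  obtain ⟨g, h, hg, hh, u, hu, t1, t2, t3, t4⟩ := h
  obtain ⟨N1, m1⟩ := exists_forall_ge_memLp
    (fun n => (hu n).continuous.aestronglyMeasurable) t1
  obtain ⟨N2, m2⟩ := exists_forall_ge_memLp
    (fun n => (continuous_fderiv_apply (hu n) _).aestronglyMeasurable) t2
  obtain ⟨N3, m3⟩ := exists_forall_ge_memLp
    (fun n => (continuous_fderiv_apply (hu n) _).aestronglyMeasurable) t3
  obtain ⟨N4, m4⟩ := exists_forall_ge_memLp
    (fun n => ((hu n).continuous.comp hγ).aestronglyMeasurable) t4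
  -- The approximating functions are only eventually square integrable; the first terms are
  -- discarded.
  let N := N1 + N2 + N3 + N4
  have a1 (n : ℕ) := m1 (n + N) (by omega)
  have a2 (n : ℕ) := m2 (n + N) (by omega)
  have a3 (n : ℕ) := m3 (n + N) (by omega)
  have a4 (n : ℕ) := m4 (n + N) (by omega)
  have hN := tendsto_add_atTop_nat N
  exact ⟨g, h, hg, hh, fun n => u (n + N), fun n => (a1 n).toLp, fun n => (a2 n).toLp,
    fun n => (a3 n).toLp, fun n => (a4 n).toLp, fun n => hu _, fun n => (a1 n).coeFn_toLp,
    fun n => (a2 n).coeFn_toLp, fun n => (a3 n).coeFn_toLp, fun n => (a4 n).coeFn_toLp,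
    (tendsto_toLp a1).2 (t1.comp hN), (tendsto_toLp a2).2 (t2.comp hN),
    (tendsto_toLp a3).2 (t3.comp hN), (tendsto_toLp a4).2 (t4.comp hN)⟩

theorem TraceBound.exists_norm_le {d : ℝ} {γ : ℝ → ℝ × ℝ} (hγ : TraceBound d γ) :
    ∃ C : ℝ, 0 ≤ C ∧ ∀ (u : ℝ × ℝ → ℂ) (U G H : L2 d) (T : Lp ℂ 2 halfLine), ContDiff ℝ ∞ u →
      U =ᵐ[stripMeasure d] u → G =ᵐ[stripMeasure d] (fun p => fderiv ℝ u p (1, 0)) →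
      H =ᵐ[stripMeasure d] (fun p => fderiv ℝ u p (0, 1)) → T =ᵐ[halfLine] (fun s => u (γ s)) →
      ‖T‖ ≤ C * (‖U‖ + ‖G‖ + ‖H‖) := by
  obtain ⟨-, C, hC, h⟩ := hγ
  refine ⟨C, hC, fun u U G H T hu h1 h2 h3 h4 => ?_⟩
  have h5 := h u hu
  rw [← eLpNorm_congr_ae h1, ← eLpNorm_congr_ae h2, ← eLpNorm_congr_ae h3,
    ← eLpNorm_congr_ae h4] at h5
  have f1 := Lp.eLpNorm_ne_top U
  have f2 := Lp.eLpNorm_ne_top G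
  have f3 := Lp.eLpNorm_ne_top H
  have h6 := ENNReal.toReal_mono (ENNReal.mul_ne_top ENNReal.ofReal_ne_top
    (ENNReal.add_ne_top.2 ⟨ENNReal.add_ne_top.2 ⟨f1, f2⟩, f3⟩)) h5
  rwa [ENNReal.toReal_mul, ENNReal.toReal_ofReal hC,
    ENNReal.toReal_add (ENNReal.add_ne_top.2 ⟨f1, f2⟩) f3, ENNReal.toReal_add f1 f2] at h6

/-- The trace operator is bounded on `H¹(Ω)`. -/
theorem TraceBound.exists_trace_le {d : ℝ} {γ : ℝ → ℝ × ℝ} (hγ : TraceBound d γ) :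
    ∃ C : ℝ, 0 ≤ C ∧ ∀ (φ : L2 d) (τ : Lp ℂ 2 halfLine), HasTrace d γ φ τ →
      ‖τ‖ ≤ C * (‖φ‖ + ‖weakDeriv d (1, 0) φ‖ + ‖weakDeriv d (0, 1) φ‖) := by
  obtain ⟨C, hC, h⟩ := hγ.exists_norm_le
  refine ⟨C, hC, fun φ τ hτ => ?_⟩
  obtain ⟨g, k, hg, hk, u, U, G, H, T, hu, h1, h2, h3, h4, t1, t2, t3, t4⟩ :=
    hτ.exists_Lp hγ.1
  rw [weakDeriv_eq hg, weakDeriv_eq hk]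
  exact le_of_tendsto_of_tendsto' t4.norm (((t1.norm.add t2.norm).add t3.norm).const_mul C)
    fun n => h _ _ _ _ _ (hu n) (h1 n) (h2 n) (h3 n) (h4 n)

/-- The difference of two traces is a trace of `0`, and the norm bound forces it to vanish. -/
theorem TraceBound.trace_unique {d : ℝ} {γ : ℝ → ℝ × ℝ} (hγ : TraceBound d γ) {φ : L2 d}
    {σ τ : Lp ℂ 2 halfLine} (h1 : HasTrace d γ φ σ) (h2 : HasTrace d γ φ τ) : σ = τ := by
  obtain ⟨C, -, h⟩ := hγ.exists_trace_le
  have h3 := h1.add hγ.1 (h2.smul (-1))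
  rw [neg_one_smul, neg_one_smul, add_neg_cancel] at h3
  have h4 := h _ _ h3
  rw [weakDeriv_eq (.zero d _), weakDeriv_eq (.zero d _)] at h4
  simp only [norm_zero, add_zero, mul_zero, norm_le_zero_iff] at h4
  rwa [add_neg_eq_zero] at h4

/-- The bound applied to differences of smooth approximants makes their restrictions a Cauchy
sequence in `L²(0, ∞)`. -/
theorem TraceBound.exists_trace {d : ℝ} (hd : 0 < d) {γ : ℝ → ℝ × ℝ} (hγ : TraceBound d γ)
    {φ : L2 d} (hφ : φ ∈ H1 d) : ∃ τ, HasTrace d γ φ τ := by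
  obtain ⟨⟨g, hg⟩, h, hh⟩ := hφ
  obtain ⟨u, hu, t1, t2, t3⟩ := exists_smooth_approx hd hg hh
  obtain ⟨N1, m1⟩ := exists_forall_ge_memLp
    (fun n => (hu n).continuous.aestronglyMeasurable) t1
  obtain ⟨N2, m2⟩ := exists_forall_ge_memLp
    (fun n => (continuous_fderiv_apply (hu n) _).aestronglyMeasurable) t2
  obtain ⟨N3, m3⟩ := exists_forall_ge_memLp
    (fun n => (continuous_fderiv_apply (hu n) _).aestronglyMeasurable) t3
  let N := N1 + N2 + N3
  have a1 (n : ℕ) := m1 (n + N) (by omega)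
  have a2 (n : ℕ) := m2 (n + N) (by omega)
  have a3 (n : ℕ) := m3 (n + N) (by omega)
  have hN := tendsto_add_atTop_nat N
  have s1 := (tendsto_toLp a1).2 (t1.comp hN)
  have s2 := (tendsto_toLp a2).2 (t2.comp hN)
  have s3 := (tendsto_toLp a3).2 (t3.comp hN)
  have a4 (n : ℕ) : MemLp (fun s => u (n + N) (γ s)) 2 halfLine := by
    refine ⟨((hu _).continuous.comp hγ.1).aestronglyMeasurable, ?_⟩
    obtain ⟨-, C, hC, h⟩ := hγ
    refine (h _ (hu (n + N))).trans_lt (ENNReal.mul_lt_top ENNReal.ofReal_lt_top ?_)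
    exact ENNReal.add_lt_top.2 ⟨ENNReal.add_lt_top.2 ⟨(a1 n).2, (a2 n).2⟩, (a3 n).2⟩
  obtain ⟨C, hC, hb⟩ := hγ.exists_norm_le
  have hdist (n m : ℕ) : dist (a4 n).toLp (a4 m).toLp ≤
      C * (dist (a1 n).toLp (a1 m).toLp + dist (a2 n).toLp (a2 m).toLp +
        dist (a3 n).toLp (a3 m).toLp) := by
    simp only [dist_eq_norm]
    have hsub {X : Type} [MeasurableSpace X] {μ : Measure X} {f g : X → ℂ} (hf : MemLp f 2 μ)
        (hg : MemLp g 2 μ) : (hf.toLp - hg.toLp : Lp ℂ 2 μ) =ᵐ[μ] fun x => f x - g x := by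
      rw [← MemLp.toLp_sub]
      exact (hf.sub hg).coeFn_toLp
    have hd (p v : ℝ × ℝ) : fderiv ℝ (fun p => u (n + N) p - u (m + N) p) p v =
        fderiv ℝ (u (n + N)) p v - fderiv ℝ (u (m + N)) p v := by
      rw [fderiv_fun_sub ((hu _).differentiable (by simp) p) ((hu _).differentiable (by simp) p)]
      rfl
    refine hb (fun p => u (n + N) p - u (m + N) p) _ _ _ _ ((hu _).sub (hu _)) (hsub _ _) ?_ ?_
      (hsub _ _)
    · simp only [hd]
      exact hsub _ _
    · simp only [hd]
      exact hsub _ _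
  have hcau : CauchySeq fun n => (a4 n).toLp := by
    rw [cauchySeq_iff_tendsto_dist_atTop_0]
    have c (f : ℕ → L2 d) (x : L2 d) (hf : Tendsto f atTop (𝓝 x)) :=
      cauchySeq_iff_tendsto_dist_atTop_0.1 hf.cauchySeq
    have := (((c _ _ s1).add (c _ _ s2)).add (c _ _ s3)).const_mul C
    simp only [add_zero, mul_zero] at this
    exact squeeze_zero (fun _ => dist_nonneg) (fun q => hdist q.1 q.2) this
  obtain ⟨τ, hτ⟩ := cauchySeq_tendsto_of_complete hcau
  exact ⟨τ, g, h, hg, hh, fun n => u (n + N), fun n => hu _, t1.comp hN, t2.comp hN, t3.comp hN,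
    (tendsto_toLp a4).1 hτ⟩

theorem TraceBound.existsUnique_trace {d : ℝ} (hd : 0 < d) {γ : ℝ → ℝ × ℝ}
    (hγ : TraceBound d γ) {φ : L2 d} (hφ : φ ∈ H1 d) : ∃! τ, HasTrace d γ φ τ := by
  obtain ⟨τ, hτ⟩ := hγ.exists_trace hd hφ
  exact ⟨τ, hτ, fun _ h => hγ.trace_unique h hτ⟩

theorem hasWeakDeriv_weakDeriv_fst {d : ℝ} {φ : L2 d} (hφ : φ ∈ H1 d) :
    HasWeakDeriv d (1, 0) φ (weakDeriv d (1, 0) φ) := by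
  obtain ⟨⟨g, hg⟩, -⟩ := hφ
  rwa [weakDeriv_eq hg]

theorem hasWeakDeriv_weakDeriv_snd {d : ℝ} {φ : L2 d} (hφ : φ ∈ H1 d) :
    HasWeakDeriv d (0, 1) φ (weakDeriv d (0, 1) φ) := by
  obtain ⟨-, g, hg⟩ := hφ
  rwa [weakDeriv_eq hg]

theorem diagonalTrace_eq {d : ℝ} (hd : 0 < d) {φ : L2 d} {τ : Lp ℂ 2 halfLine}
    (h : HasTrace d diagonalLine φ τ) : diagonalTrace d φ = τ := by
  have hex : ∃ τ, HasTrace d diagonalLine φ τ := ⟨τ, h⟩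
  rw [diagonalTrace, dif_pos hex]
  exact (traceBound_diagonalLine hd).trace_unique hex.choose_spec h

theorem hasTrace_diagonalTrace {d : ℝ} (hd : 0 < d) {φ : L2 d} (hφ : φ ∈ H1 d) :
    HasTrace d diagonalLine φ (diagonalTrace d φ) := by
  obtain ⟨τ, hτ⟩ := (traceBound_diagonalLine hd).exists_trace hd hφ
  rwa [diagonalTrace_eq hd hτ]

/-- Traces vanish in the limit of convergence in `H¹(Ω)`. -/
theorem TraceBound.tendsto_zero {d : ℝ} {γ : ℝ → ℝ × ℝ} (hγ : TraceBound d γ) {φ : ℕ → L2 d}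
    {τ : ℕ → Lp ℂ 2 halfLine} (h : ∀ n, HasTrace d γ (φ n) (τ n))
    (h0 : Tendsto φ atTop (𝓝 0))
    (h1 : Tendsto (fun n => weakDeriv d (1, 0) (φ n)) atTop (𝓝 0))
    (h2 : Tendsto (fun n => weakDeriv d (0, 1) (φ n)) atTop (𝓝 0)) :
    Tendsto τ atTop (𝓝 0) := by
  obtain ⟨C, -, hC⟩ := hγ.exists_trace_le
  refine squeeze_zero_norm (fun n => hC _ _ (h n)) ?_
  simpa using ((h0.norm.add h1.norm).add h2.norm).const_mul C

/-! ### The form domain is dense -/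

/-- The constant sequence `u` serves as the approximation. -/
theorem hasTrace_zero_of_contDiff {d : ℝ} {γ : ℝ → ℝ × ℝ} {u : ℝ × ℝ → ℂ} (hu : ContDiff ℝ ∞ u)
    {φ g h : L2 d} (hφ : φ =ᵐ[stripMeasure d] u)
    (hg : g =ᵐ[stripMeasure d] fun p => fderiv ℝ u p (1, 0))
    (hh : h =ᵐ[stripMeasure d] fun p => fderiv ℝ u p (0, 1)) (hγ : ∀ s, u (γ s) = 0) :
    HasTrace d γ φ 0 := by
  have key {X : Type} [MeasurableSpace X] {μ : Measure X} {f : X → ℂ} {F : Lp ℂ 2 μ}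
      (hF : F =ᵐ[μ] f) : Tendsto (fun _ : ℕ => eLpNorm (fun p => f p - F p) 2 μ) atTop (𝓝 0) := by
    have : eLpNorm (fun p => f p - F p) 2 μ = 0 := by
      rw [← eLpNorm_zero (p := 2) (μ := μ) (ε := ℂ)]
      refine eLpNorm_congr_ae ?_
      filter_upwards [hF] with p hp
      rw [hp, sub_self, Pi.zero_apply]
    rw [this]
    exact tendsto_const_nhds
  refine ⟨g, h, hasWeakDeriv_of_contDiff hu hφ hg, hasWeakDeriv_of_contDiff hu hφ hh, fun _ => u,
    fun _ => hu, key hφ, key hg, key hh, key ?_⟩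
  filter_upwards [Lp.coeFn_zero ℂ 2 halfLine] with s hs
  rw [hs, hγ, Pi.zero_apply]

theorem lowerLine_notMem_interior (d s : ℝ) : lowerLine d s ∉ interior (strip d) := fun h => by
  have := abs_sub_lt_of_mem_interior_strip h
  rw [lowerLine, add_sub_cancel_left] at this
  exact absurd this (not_lt.2 (le_abs_self d))

theorem upperLine_notMem_interior (d s : ℝ) : upperLine d s ∉ interior (strip d) := fun h => by
  have := abs_sub_lt_of_mem_interior_strip h
  rw [upperLine, sub_add_cancel_left, abs_neg] at this
  exact absurd this (not_lt.2 (le_abs_self d))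

theorem dense_formDomain (d : ℝ) : Dense (formDomain d : Set (L2s d)) := by
  rw [Submodule.dense_iff_topologicalClosure_eq_top, Submodule.topologicalClosure_eq_top_iff,
    Submodule.eq_bot_iff]
  intro ψ hψ
  refine Subtype.ext (eq_zero_of_forall_test (φ := (ψ : L2 d)) fun η h1 h2 h3 => ?_)
  -- Symmetrising an arbitrary test function gives an element of the form domain. Since `ψ` is
  -- symmetric, both summands have the same integral against it, so orthogonality reads `2 ∫ η ψ =
  -- 0`.
  let ζ : ℝ × ℝ → ℝ := fun p => η p + η p.swap
  have hs : ContDiff ℝ ∞ (fun p : ℝ × ℝ => η p.swap) := h1.comp (contDiff_snd.prodMk contDiff_fst)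
  have hsc : HasCompactSupport (fun p : ℝ × ℝ => η p.swap) :=
    h2.comp_homeomorph (Homeomorph.prodComm ℝ ℝ)
  have hζ : ContDiff ℝ ∞ (fun p => (ζ p : ℂ)) := Complex.ofRealCLM.contDiff.comp (h1.add hs)
  have hζc : HasCompactSupport (fun p => (ζ p : ℂ)) := hasCompactSupport_ofReal (h2.add hsc)
  have hZ := coeFn_toL2 d hζ.continuous hζc
  have hG (v : ℝ × ℝ) := coeFn_toL2 d (continuous_fderiv_apply hζ v) (hζc.fderiv_apply ℝ v)
  set Z : L2 d := toL2 d hζ.continuous hζc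
  have hout {p : ℝ × ℝ} (hp : p ∉ interior (strip d)) : η p = 0 :=
    image_eq_zero_of_notMem_tsupport fun h => hp (h3 h)
  have hsym : Z ∈ L2s d := by
    change ∀ᵐ p ∂stripMeasure d, Z p.swap = Z p
    filter_upwards [hZ, (measurePreserving_swap d).quasiMeasurePreserving.ae hZ] with p hp hq
    rw [hp, hq]
    simp only [ζ, Prod.swap_swap, add_comm]
  have hl (s : ℝ) : (ζ (lowerLine d s) : ℂ) = 0 := by
    have : η (lowerLine d s).swap = 0 := hout (upperLine_notMem_interior d s)
    simp only [ζ, this, hout (lowerLine_notMem_interior d s), add_zero, Complex.ofReal_zero]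
  have hu (s : ℝ) : (ζ (upperLine d s) : ℂ) = 0 := by
    have : η (upperLine d s).swap = 0 := hout (lowerLine_notMem_interior d s)
    simp only [ζ, this, hout (upperLine_notMem_interior d s), add_zero, Complex.ofReal_zero]
  have hmem : (⟨Z, hsym⟩ : L2s d) ∈ formDomain d :=
    ⟨⟨⟨_, hasWeakDeriv_of_contDiff hζ hZ (hG _)⟩, ⟨_, hasWeakDeriv_of_contDiff hζ hZ (hG _)⟩⟩,
      hasTrace_zero_of_contDiff hζ hZ (hG _) (hG _) hl,
      hasTrace_zero_of_contDiff hζ hZ (hG _) (hG _) hu⟩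
  have h4 : inner ℂ Z (ψ : L2 d) = 0 := (Submodule.mem_orthogonal _ ψ).1 hψ _ hmem
  rw [inner_toL2_ofReal] at h4
  have h5 : ∫ p in strip d, (η p.swap : ℂ) * (ψ : L2 d) p =
      ∫ p in strip d, (η p : ℂ) * (ψ : L2 d) p := by
    rw [← (measurePreserving_swap d).integral_comp MeasurableEquiv.prodComm.measurableEmbedding]
    refine integral_congr_ae ?_
    filter_upwards [ψ.2] with p hp
    rw [hp, Prod.swap_swap]
  have h6 : ∫ p in strip d, (ζ p : ℂ) * (ψ : L2 d) p =
      (∫ p in strip d, (η p : ℂ) * (ψ : L2 d) p) +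
        ∫ p in strip d, (η p.swap : ℂ) * (ψ : L2 d) p := by
    rw [← integral_add (integrable_mul_L2 h1.continuous h2 _)
      (integrable_mul_L2 hs.continuous hsc _)]
    simp only [ζ, Complex.ofReal_add, add_mul]
  rw [h6, h5, ← two_mul] at h4
  exact (mul_eq_zero.1 h4).resolve_left two_ne_zero

/-! ### The form as the square of a closed map -/

theorem continuous_diagonalLine : Continuous diagonalLine := continuous_id.prodMk continuous_id

/-- The Hilbert space `L²(Ω) ⊕ L²(Ω) ⊕ L²(0, ∞)`. -/
abbrev FormSpace (d : ℝ) : Type := WithLp 2 (L2 d × WithLp 2 (L2 d × Lp ℂ 2 halfLine))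

/-- The map `φ ↦ (∂₁φ, ∂₂φ, √α φ(x, x))`, with `q_α[φ] = ‖formMap φ‖²`. -/
noncomputable def formMap {d : ℝ} (hd : 0 < d) (α : ℝ) : formDomain d →ₗ[ℂ] FormSpace d where
  toFun φ := WithLp.toLp 2 (weakDeriv d (1, 0) φ,
    WithLp.toLp 2 (weakDeriv d (0, 1) φ, (√α : ℂ) • diagonalTrace d φ))
  map_add' φ ψ := by
    have h1 := φ.2.1
    have h2 := ψ.2.1
    have e1 := weakDeriv_eq ((hasWeakDeriv_weakDeriv_fst h1).add (hasWeakDeriv_weakDeriv_fst h2))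
    have e2 := weakDeriv_eq ((hasWeakDeriv_weakDeriv_snd h1).add (hasWeakDeriv_weakDeriv_snd h2))
    have e3 := diagonalTrace_eq hd ((hasTrace_diagonalTrace hd h1).add continuous_diagonalLine
      (hasTrace_diagonalTrace hd h2))
    simp only [Submodule.coe_add, e1, e2, e3, smul_add]
    rfl
  map_smul' c φ := by
    have h1 := φ.2.1
    have e1 := weakDeriv_eq ((hasWeakDeriv_weakDeriv_fst h1).smul c)
    have e2 := weakDeriv_eq ((hasWeakDeriv_weakDeriv_snd h1).smul c)
    have e3 := diagonalTrace_eq hd ((hasTrace_diagonalTrace hd h1).smul c)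
    simp only [Submodule.coe_smul, e1, e2, e3, smul_comm (√α : ℂ) c, RingHom.id_apply]
    rfl

theorem inner_eq_integral_conj_mul {X : Type*} [MeasurableSpace X] {μ : Measure X}
    (f g : Lp ℂ 2 μ) : inner ℂ f g = ∫ x, conj (f x) * g x ∂μ := by
  rw [L2.inner_def]
  simp only [RCLike.inner_apply, mul_comm]

theorem integrable_conj_mul {X : Type*} [MeasurableSpace X] {μ : Measure X}
    (f g : Lp ℂ 2 μ) : Integrable (fun x => conj (f x) * g x) μ := by
  have := L2.integrable_inner (𝕜 := ℂ) f g
  simpa only [RCLike.inner_apply, mul_comm] using this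

theorem sesqForm_eq_inner {d α : ℝ} (hd : 0 < d) (hα : 0 ≤ α) (φ ψ : formDomain d) :
    sesqForm d α φ ψ = inner ℂ (formMap hd α φ) (formMap hd α ψ) := by
  rw [WithLp.prod_inner_apply, WithLp.prod_inner_apply]
  change _ = inner ℂ (weakDeriv d (1, 0) φ) (weakDeriv d (1, 0) ψ) +
    (inner ℂ (weakDeriv d (0, 1) φ) (weakDeriv d (0, 1) ψ) +
      inner ℂ ((√α : ℂ) • diagonalTrace d φ) ((√α : ℂ) • diagonalTrace d ψ))
  rw [inner_smul_left, inner_smul_right, Complex.conj_ofReal, ← mul_assoc, ← Complex.ofReal_mul,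
    Real.mul_self_sqrt hα, sesqForm, integral_add (integrable_conj_mul _ _)
    (integrable_conj_mul _ _), inner_eq_integral_conj_mul, inner_eq_integral_conj_mul,
    inner_eq_integral_conj_mul, add_assoc]

theorem sesqForm_self (d α : ℝ) (φ : formDomain d) :
    sesqForm d α φ φ = (quadForm d α φ : ℂ) := by
  have h (z : ℂ) : conj z * z = ((‖z‖ ^ 2 : ℝ) : ℂ) := by
    rw [Complex.conj_mul', Complex.ofReal_pow]
  simp only [sesqForm, quadForm, h, ← Complex.ofReal_add, integral_complex_ofReal,
    ← Complex.ofReal_mul]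

theorem quadForm_eq_norm_sq {d α : ℝ} (hd : 0 < d) (hα : 0 ≤ α) (φ : formDomain d) :
    quadForm d α φ = ‖formMap hd α φ‖ ^ 2 := by
  have h := sesqForm_self d α φ
  rw [sesqForm_eq_inner hd hα, inner_self_eq_norm_sq_to_K] at h
  exact Complex.ofReal_injective (h.symm.trans (by push_cast; rfl))

theorem norm_sq_formMap {d α : ℝ} (hd : 0 < d) (φ : formDomain d) :
    ‖formMap hd α φ‖ ^ 2 = ‖weakDeriv d (1, 0) φ‖ ^ 2 +
      (‖weakDeriv d (0, 1) φ‖ ^ 2 + ‖(√α : ℂ) • diagonalTrace d φ‖ ^ 2) := by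
  rw [WithLp.prod_norm_sq_eq_of_L2, WithLp.prod_norm_sq_eq_of_L2]
  rfl

/-- Completeness of `FormSpace` supplies limits of the derivatives, which are the weak derivatives
of `x`; hence `uₙ → x` in `H¹(Ω)`, and continuity of the traces does the rest. -/
theorem formClosed_formMap {d : ℝ} (hd : 0 < d) (α : ℝ) :
    FormClosed (formDomain d) fun φ => ‖formMap hd α φ‖ ^ 2 := by
  intro u x hux hq
  have hcau : CauchySeq fun n => formMap hd α (u n) := by
    rw [cauchySeq_iff_tendsto_dist_atTop_0]
    have h := hq.sqrt
    rw [Real.sqrt_zero] at h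
    refine h.congr fun k => ?_
    rw [Real.sqrt_sq (norm_nonneg _), map_sub, dist_eq_norm]
  obtain ⟨z, hz⟩ := cauchySeq_tendsto_of_complete hcau
  have t0 : Tendsto (fun n => ((u n : L2s d) : L2 d)) atTop (𝓝 (x : L2 d)) :=
    (continuous_subtype_val.tendsto x).comp hux
  have t1 : Tendsto (fun n => weakDeriv d (1, 0) (u n)) atTop (𝓝 z.fst) :=
    ((WithLp.continuous_fst 2 _ _).tendsto z).comp hz
  have t2 : Tendsto (fun n => weakDeriv d (0, 1) (u n)) atTop (𝓝 z.snd.fst) :=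
    ((WithLp.continuous_fst 2 _ _).tendsto z.snd).comp
      (((WithLp.continuous_snd 2 _ _).tendsto z).comp hz)
  have w1 := HasWeakDeriv.of_tendsto (fun n => hasWeakDeriv_weakDeriv_fst (u n).2.1) t0 t1
  have w2 := HasWeakDeriv.of_tendsto (fun n => hasWeakDeriv_weakDeriv_snd (u n).2.1) t0 t2
  have hxH : (x : L2 d) ∈ H1 d := ⟨⟨_, w1⟩, _, w2⟩
  have s0 : Tendsto (fun n => ((u n : L2s d) : L2 d) - x) atTop (𝓝 0) := by
    simpa using t0.sub_const (x : L2 d)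
  have hsub {v : ℝ × ℝ} {z : L2 d} (hw : HasWeakDeriv d v x z)
      (hu : ∀ n, HasWeakDeriv d v (u n) (weakDeriv d v (u n)))
      (t : Tendsto (fun n => weakDeriv d v (u n)) atTop (𝓝 z)) :
      Tendsto (fun n => weakDeriv d v (((u n : L2s d) : L2 d) - x)) atTop (𝓝 0) := by
    have h1 := t.sub_const z
    rw [sub_self] at h1
    refine h1.congr fun n => ?_
    have h2 := (hu n).add (hw.smul (-1))
    rw [neg_one_smul, neg_one_smul, ← sub_eq_add_neg, ← sub_eq_add_neg] at h2
    exact (weakDeriv_eq h2).symm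
  have s1 := hsub w1 (fun n => hasWeakDeriv_weakDeriv_fst (u n).2.1) t1
  have s2 := hsub w2 (fun n => hasWeakDeriv_weakDeriv_snd (u n).2.1) t2
  -- The trace `τ` of `x` exists, and `uₙ - x` has the constant trace `-τ`, which must tend to `0`.
  have htr {γ : ℝ → ℝ × ℝ} (hγ : TraceBound d γ) (h : ∀ n, HasTrace d γ (u n) 0) :
      HasTrace d γ x 0 := by
    obtain ⟨τ, hτ⟩ := hγ.exists_trace hd hxH
    have h1 (n : ℕ) : HasTrace d γ (((u n : L2s d) : L2 d) - x) (-τ) := by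
      have := (h n).add hγ.1 (hτ.smul (-1))
      rwa [neg_one_smul, neg_one_smul, ← sub_eq_add_neg, zero_add] at this
    have h2 := tendsto_nhds_unique tendsto_const_nhds (hγ.tendsto_zero h1 s0 s1 s2)
    rwa [neg_eq_zero.1 h2] at hτ
  refine ⟨⟨hxH, htr (traceBound_lowerLine hd) fun n => (u n).2.2.1,
    htr (traceBound_upperLine hd) fun n => (u n).2.2.2⟩, ?_⟩
  -- The diagonal term is controlled by `H¹` convergence alone; the limit of the third component of
  -- `formMap` is not needed, so `α = 0` requires no separate treatment.
  have s3 := (traceBound_diagonalLine hd).tendsto_zero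
    (fun n => hasTrace_diagonalTrace hd ((H1 d).sub_mem (u n).2.1 hxH)) s0 s1 s2
  simp only [norm_sq_formMap]
  simpa using (s1.norm.pow 2).add ((s2.norm.pow 2).add ((s3.const_smul (√α : ℂ)).norm.pow 2))

end PairForm

open PairForm in
theorem mainTheorem5 (d α : ℝ) (hd : 0 < d) (hα : 0 ≤ α) :
    -- the weak gradient and the traces are well defined on `H¹(Ω)`
    (∀ φ ∈ H1 d,
      (∃! g, HasWeakDeriv d (1, 0) φ g) ∧ (∃! g, HasWeakDeriv d (0, 1) φ g) ∧
      (∃! τ, HasTrace d diagonalLine φ τ) ∧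
      (∃! τ, HasTrace d (lowerLine d) φ τ) ∧ (∃! τ, HasTrace d (upperLine d) φ τ)) ∧
    -- `q_α` is the quadratic form of a sesquilinear form
    (∃ a : formDomain d →ₗ⋆[ℂ] formDomain d →ₗ[ℂ] ℂ, ∀ φ ψ, a φ ψ = sesqForm d α φ ψ) ∧
    (∀ φ, sesqForm d α φ φ = (quadForm d α φ : ℂ)) ∧
    -- densely defined, closed, bounded from below
    Dense (formDomain d : Set (L2s d)) ∧
    FormClosed (formDomain d) (quadForm d α) ∧
    FormBoundedBelow (formDomain d) (quadForm d α) ∧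
    -- the self-adjoint operator `H_α`
    (∃ H : L2s d →ₗ.[ℂ] L2s d, IsSelfAdjoint H ∧
      FormAssociatedOperator (formDomain d) (sesqForm d α) H ∧
      ∀ H' : L2s d →ₗ.[ℂ] L2s d, IsSelfAdjoint H' →
        FormRepresentedBy (formDomain d) (sesqForm d α) H' → H' = H) := by
  have hclosed := formClosed_formMap hd α
  refine ⟨fun φ hφ => ⟨⟨_, hasWeakDeriv_weakDeriv_fst hφ, fun _ h => (weakDeriv_eq h).symm⟩,
      ⟨_, hasWeakDeriv_weakDeriv_snd hφ, fun _ h => (weakDeriv_eq h).symm⟩,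
      (traceBound_diagonalLine hd).existsUnique_trace hd hφ,
      (traceBound_lowerLine hd).existsUnique_trace hd hφ,
      (traceBound_upperLine hd).existsUnique_trace hd hφ⟩,
    ⟨((innerₛₗ ℂ).comp (formMap hd α)).compl₂ (formMap hd α),
      fun φ ψ => (sesqForm_eq_inner hd hα φ ψ).symm⟩,
    sesqForm_self d α, dense_formDomain d, ?_, ⟨0, fun φ => ?_⟩,
    exists_formAssociatedOperator (dense_formDomain d) hclosed (sesqForm_eq_inner hd hα)⟩
  · simpa only [← quadForm_eq_norm_sq hd hα] using hclosed
  · rw [zero_mul, quadForm_eq_norm_sq hd hα]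
    positivity
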